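/- **Theorem.** Let $n\ge 2$ and let $-L$ be a Kossakowski–Lindblad generator on $\mathbb C^{n\times n}$, that is, a linear map of the form $$-L(\rho)=-\mathrm i[H_0,\rho]+\sum_{k=1}^r\Big(V_k\rho V_k^*-\tfrac12\big(V_k^*V_k\rho+\rho V_k^*V_k\big)\Big)$$ with $H_0$ Hermitian and arbitrary Lindblad terms $V_1,\dots,V_r\in\mathbb C^{n\times n}$. (Neither $H_0$ nor the $V_k$, nor their number, is uniquely determined by $L$.) Let $\Delta^{n-1}\subset\mathbb R^n$ be the standard simplex with vertices $e_1,\dots,e_n$. For $U\in\mathrm{SU}(n)$ set $$J(U)_{ij}=\sum_{k=1}^r|\langle i|U^*V_kU|j\rangle|^2,\qquad -L_U=J(U)-\operatorname{diag}\big(J(U)^\top(1,\dots,1)^\top\big).$$ For $I=[0,T]$ or $I=[0,\infty)$, a solution of the *reduced control system* on $I$ is a (locally) absolutely continuous $\lambda:I\to\Delta^{n-1}$ for which there is a measurable $U:I\to\mathrm{SU}(n)$ with $\dot\lambda(t)=-L_{U(t)}\lambda(t)$ for almost every $t\in I$. For $\lambda_0\in\Delta^{n-1}$ let $\mathsf{reach}(\lambda_0)$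 be the set of all $\lambda(T)$, where $T\ge0$ and $\lambda$ is a solution on $[0,T]$ with $\lambda(0)=\lambda_0$. Then the following are equivalent. 1. For every choice of Lindblad terms $\{V'_k\}_{k=1}^{r'}$ representing $-L$ (together with some Hermitian $H_0'$), there is a common eigenvector $\psi\neq0$ of all $V'_k$ which is not a common left eigenvector, i.e. it is not the case that for every $k$ the row vector $\psi^*V'_k$ is a scalar multiple of $\psi^*$. 2. There is a (time-independent) Hermitian matrix $H$ such that $-(\mathrm i\,\mathrm{ad}_H+L)$, where $\mathrm{ad}_H=[H,\cdot\,]$, has a (unique) attractive fixed point, i.e. a density matrix $\rho_\infty$ which is a fixed point and to which every solution of $\dot\rho=-(\mathrm i\,\mathrm{ad}_H+L)(\rho)$ in the set of density matrices converges as $t\to\infty$, and this fixed point is pure, i.e. $\rho_\infty=\psi\psi^*$ for a unit vector $\psi$. 3. For every $\lambda_0\in\Delta^{n-1}$ there is a solution $\lambda:[0,\infty)\to\Delta^{n-1}$ of the reduced control system with $\lambda(0)=\lambda_0$ and $\lambda(t)\to e_1$ as $t\to\infty$. 4. There is $\lambda_0\in\Delta^{n-1}\setminus\{e_1\}$ such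 that $e_1\in\overline{\mathsf{reach}(\lambda_0)}$. -/

import Mathlib

namespace MarkovCooling

noncomputable section

open Filter Topology MeasureTheory Set
open scoped Matrix ComplexOrder

/-- The superoperator `ad_H`, that is `ρ ↦ [H, ρ]`. -/
def ad {n : ℕ} (H : Matrix (Fin n) (Fin n) ℂ) :
    Matrix (Fin n) (Fin n) ℂ →ₗ[ℂ] Matrix (Fin n) (Fin n) ℂ :=
  LinearMap.mulLeft ℂ H - LinearMap.mulRight ℂ H

/-- `-L` is the Kossakowski-Lindblad generator with Hamiltonian `H₀` and Lindblad terms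
`V 0, …, V (r - 1)`:
`-L(ρ) = -i [H₀, ρ] + ∑ k, (V k ρ (V k)ᴴ - 1/2 ((V k)ᴴ V k ρ + ρ (V k)ᴴ V k))`. -/
def HasLindbladForm {n r : ℕ}
    (L : Matrix (Fin n) (Fin n) ℂ →ₗ[ℂ] Matrix (Fin n) (Fin n) ℂ)
    (H₀ : Matrix (Fin n) (Fin n) ℂ) (V : Fin r → Matrix (Fin n) (Fin n) ℂ) : Prop :=
  H₀.IsHermitian ∧
    ∀ ρ : Matrix (Fin n) (Fin n) ℂ,
      -(L ρ) = -(Complex.I • ad H₀ ρ) +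
        ∑ k, (V k * ρ * (V k)ᴴ - (1 / 2 : ℂ) • ((V k)ᴴ * V k * ρ + ρ * ((V k)ᴴ * V k)))

/-- `ψ` is a common (right) eigenvector of all the matrices `V k`. -/
def IsCommonEigenvector {n r : ℕ} (V : Fin r → Matrix (Fin n) (Fin n) ℂ)
    (ψ : Fin n → ℂ) : Prop :=
  ψ ≠ 0 ∧ ∀ k, ∃ α : ℂ, V k *ᵥ ψ = α • ψ

/-- `ψ` is a common left eigenvector of all the matrices `V k`: `ψ* V k = α_k ψ*`. -/
def IsCommonLeftEigenvector {n r : ℕ} (V : Fin r → Matrix (Fin n) (Fin n) ℂ)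
    (ψ : Fin n → ℂ) : Prop :=
  ψ ≠ 0 ∧ ∀ k, ∃ α : ℂ, star ψ ᵥ* V k = α • star ψ

/-- Density matrices: positive semidefinite matrices of unit trace. -/
def densityMatrices (n : ℕ) : Set (Matrix (Fin n) (Fin n) ℂ) :=
  {ρ | ρ.PosSemidef ∧ ρ.trace = 1}

/-- Pure states: the rank one projections `ψ ψ*` with `ψ` a unit vector. -/
def IsPure {n : ℕ} (ρ : Matrix (Fin n) (Fin n) ℂ) : Prop :=
  ∃ ψ : Fin n → ℂ, star ψ ⬝ᵥ ψ = 1 ∧ ρ = Matrix.vecMulVec ψ (star ψ)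

/-- `ρ : [0, ∞) → {density matrices}` solves the autonomous equation `ρ' = G(ρ)`
(derivatives are taken entrywise; values at negative times are irrelevant). -/
def IsSolution {n : ℕ}
    (G : Matrix (Fin n) (Fin n) ℂ →ₗ[ℂ] Matrix (Fin n) (Fin n) ℂ)
    (ρ : ℝ → Matrix (Fin n) (Fin n) ℂ) : Prop :=
  (∀ t, 0 ≤ t → ρ t ∈ densityMatrices n) ∧
    ∀ t, 0 ≤ t → ∀ i j, HasDerivWithinAt (fun s => ρ s i j) (G (ρ t) i j) (Ici 0) t

/-- A density matrix `ρ` is an attractive fixed point of `G` if it is a fixed point of the flow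
of `G` and every solution in the set of density matrices converges to it. -/
def IsAttractiveFixedPoint {n : ℕ}
    (G : Matrix (Fin n) (Fin n) ℂ →ₗ[ℂ] Matrix (Fin n) (Fin n) ℂ)
    (ρ : Matrix (Fin n) (Fin n) ℂ) : Prop :=
  ρ ∈ densityMatrices n ∧ G ρ = 0 ∧
    ∀ σ : ℝ → Matrix (Fin n) (Fin n) ℂ, IsSolution G σ → Tendsto σ atTop (𝓝 ρ)

/-- The matrix `J(U)` with entries `J(U) i j = ∑ k, |⟨i| U* V_k U |j⟩|²`. -/
def jMatrix {n r : ℕ} (V : Fin r → Matrix (Fin n) (Fin n) ℂ)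
    (U : Matrix (Fin n) (Fin n) ℂ) : Matrix (Fin n) (Fin n) ℝ :=
  Matrix.of fun i j => ∑ k, ‖(Uᴴ * V k * U) i j‖ ^ 2

/-- The induced vector field `-L_U = J(U) - diag(J(U)ᵀ 𝐞)`, with `𝐞` the all-ones vector. -/
def inducedField {n r : ℕ} (V : Fin r → Matrix (Fin n) (Fin n) ℂ)
    (U : Matrix (Fin n) (Fin n) ℂ) : Matrix (Fin n) (Fin n) ℝ :=
  jMatrix V U - Matrix.diagonal ((jMatrix V U)ᵀ *ᵥ (fun _ => 1))

/-- `l : I → Δ^{n-1}` is a solution of the reduced control system `l' = -L_{U(t)} l` with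
measurable control `U : I → SU(n)`, where `I` is `[0, T]` or `[0, ∞)`: `l` is absolutely
continuous (on every `[0, S] ⊆ I`) and satisfies the equation almost everywhere on `I`.
Only the values of `l` and `U` on `I` matter. -/
def IsReducedSolution {n r : ℕ} (V : Fin r → Matrix (Fin n) (Fin n) ℂ) (I : Set ℝ)
    (l : ℝ → Fin n → ℝ) : Prop :=
  (∀ t ∈ I, l t ∈ stdSimplex ℝ (Fin n)) ∧
  (∀ S : ℝ, 0 ≤ S → Icc 0 S ⊆ I → AbsolutelyContinuousOnInterval l 0 S) ∧
  ∃ U : ℝ → Matrix.specialUnitaryGroup (Fin n) ℂ,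
    (∀ i j, Measurable fun t => (U t : Matrix (Fin n) (Fin n) ℂ) i j) ∧
    ∀ᵐ t ∂(volume.restrict I),
      HasDerivAt l (inducedField V (U t : Matrix (Fin n) (Fin n) ℂ) *ᵥ l t) t

/-- The reachable set of `l₀` at time `T` for the reduced control system. -/
def reachAt {n r : ℕ} (V : Fin r → Matrix (Fin n) (Fin n) ℂ) (l₀ : Fin n → ℝ) (T : ℝ) :
    Set (Fin n → ℝ) :=
  {x | ∃ l : ℝ → Fin n → ℝ, IsReducedSolution V (Icc 0 T) l ∧ l 0 = l₀ ∧ l T = x}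

/-- The all-time reachable set of `l₀` for the reduced control system. -/
def reach {n r : ℕ} (V : Fin r → Matrix (Fin n) (Fin n) ℂ) (l₀ : Fin n → ℝ) :
    Set (Fin n → ℝ) :=
  ⋃ T ∈ Ici (0 : ℝ), reachAt V l₀ T

end

end MarkovCooling

namespace MarkovCooling

open Filter Topology MeasureTheory Set
open scoped Matrix ComplexOrder

variable {n r : ℕ}

/-! A unit vector `ψ` that is a common eigenvector but not a common left eigenvector is a state that
jumps enter but never leave. For `φ` orthogonal to `ψ`, the matrix element of `-L(ψψ*)` at `φ` is
the total jump rate from `ψ` to `φ`. Both eigenvector conditions therefore depend only on `L`, and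
condition 1 may be tested on a single set of Lindblad terms
(`HasLindbladForm.exists_eigenvector_congr`).

For 1 → 2, shift each `V k` by its eigenvalue so that all of them annihilate `ψ`; this changes only
the Hamiltonian, which the control can replace. The population of `ψ` is then nondecreasing. By
LaSalle's principle every limit state has constant population along its trajectory, so `(V k₀)ᴴ ψ`
and its orbit under `iH - ½ ∑ Vₖ* Vₖ` lie in its kernel. A Hamiltonian making this vector cyclic on
the complement of `ψ` (`exists_cyclic_hamiltonian`) leaves only `ψψ*`. For 2 → 1, a pure fixed point
gives a common eigenvector; were it a left one too, its population would be conserved and the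
maximally mixed state could not converge to it.

For 1 → 3, a constant control suffices: complete `ψ` to a basis in which every other vector feeds it
at a positive rate (`exists_cooling_unitary`). The implication 3 → 4 starts at another vertex.

For 4 → 1, suppose every common eigenvector is a left one. Then the rate into the first basis vector
is at most `C` times the rate out, uniformly in the basis (`exists_rate_bound`). Hence the first
coordinate cannot increase above `C / (C + 1)`, and the vertex cannot be approached from any other
point. -/

/-! ### Eigenvector conditions expressed through the generator alone -/

theorem star_dotProduct_star_mulVec (V A : Matrix (Fin n) (Fin n) ℂ) (x : Fin n → ℂ) :
    star x ⬝ᵥ (V * A * Vᴴ) *ᵥ x = star (Vᴴ *ᵥ x) ⬝ᵥ A *ᵥ (Vᴴ *ᵥ x) := by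
  rw [Matrix.star_mulVec, Matrix.conjTranspose_conjTranspose, ← Matrix.mulVec_mulVec,
    ← Matrix.mulVec_mulVec, Matrix.dotProduct_mulVec]

/-- If `A` annihilates `φ` on both sides, only the jump part of a Lindblad generator contributes to
the diagonal element of its value at `A`. -/
theorem HasLindbladForm.star_dotProduct_mulVec
    {L : Matrix (Fin n) (Fin n) ℂ →ₗ[ℂ] Matrix (Fin n) (Fin n) ℂ}
    {H : Matrix (Fin n) (Fin n) ℂ} {V : Fin r → Matrix (Fin n) (Fin n) ℂ}
    (hL : HasLindbladForm L H V) {A : Matrix (Fin n) (Fin n) ℂ} {φ : Fin n → ℂ}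
    (h₁ : A *ᵥ φ = 0) (h₂ : star φ ᵥ* A = 0) :
    star φ ⬝ᵥ (-(L A)) *ᵥ φ = ∑ k, star ((V k)ᴴ *ᵥ φ) ⬝ᵥ A *ᵥ ((V k)ᴴ *ᵥ φ) := by
  have l (B : Matrix (Fin n) (Fin n) ℂ) : star φ ⬝ᵥ (B * A) *ᵥ φ = 0 := by
    rw [← Matrix.mulVec_mulVec, h₁, Matrix.mulVec_zero, dotProduct_zero]
  have l' (B : Matrix (Fin n) (Fin n) ℂ) : star φ ⬝ᵥ (A * B) *ᵥ φ = 0 := by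
    rw [← Matrix.mulVec_mulVec, Matrix.dotProduct_mulVec, h₂, zero_dotProduct]
  rw [hL.2 A]
  simp only [ad, LinearMap.sub_apply, LinearMap.mulLeft_apply, LinearMap.mulRight_apply,
    Matrix.add_mulVec, Matrix.sub_mulVec, Matrix.neg_mulVec, Matrix.smul_mulVec,
    Matrix.sum_mulVec, dotProduct_add, dotProduct_sub, dotProduct_neg, dotProduct_smul,
    dotProduct_sum, l, l', star_dotProduct_star_mulVec]
  simp

/-- The residual of `A ψ` after projection onto `ψ` is orthogonal to `ψ`, so it vanishes once tested
against itself. This removes the unknown eigenvalue and leaves matrix elements that the generator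
can see. -/
theorem exists_mulVec_eq_smul_iff {A : Matrix (Fin n) (Fin n) ℂ} {ψ : Fin n → ℂ} (hψ : ψ ≠ 0) :
    (∃ α : ℂ, A *ᵥ ψ = α • ψ) ↔
      ∀ φ : Fin n → ℂ, star φ ⬝ᵥ ψ = 0 → star φ ⬝ᵥ A *ᵥ ψ = 0 := by
  constructor
  · rintro ⟨α, hα⟩ φ hφ
    rw [hα, dotProduct_smul, hφ, smul_zero]
  · intro h
    have h0 : star ψ ⬝ᵥ ψ ≠ 0 := fun h => hψ (dotProduct_star_self_eq_zero.1 h)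
    set α := (star ψ ⬝ᵥ A *ᵥ ψ) / (star ψ ⬝ᵥ ψ) with hα
    refine ⟨α, sub_eq_zero.1 (dotProduct_star_self_eq_zero.1 (?_ : star (A *ᵥ ψ - α • ψ) ⬝ᵥ _ = 0))⟩
    have h1 : star ψ ⬝ᵥ (A *ᵥ ψ - α • ψ) = 0 := by
      rw [dotProduct_sub, dotProduct_smul, smul_eq_mul, hα, div_mul_cancel₀ _ h0, sub_self]
    have h2 : star (A *ᵥ ψ - α • ψ) ⬝ᵥ ψ = 0 := by
      have := congrArg star h1
      rwa [star_zero, Matrix.star_dotProduct, star_star] at this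
    rw [dotProduct_sub, h _ h2, dotProduct_smul, h2, smul_zero, sub_zero]

theorem star_dotProduct_vecMulVec_mulVec (x ψ : Fin n → ℂ) :
    star x ⬝ᵥ Matrix.vecMulVec ψ (star ψ) *ᵥ x = (‖star ψ ⬝ᵥ x‖ ^ 2 : ℝ) := by
  rw [Matrix.vecMulVec_mulVec, op_smul_eq_smul, dotProduct_smul, smul_eq_mul,
    Matrix.star_dotProduct x ψ, ← Complex.normSq_eq_norm_sq, Complex.normSq_eq_conj_mul_self,
    mul_comm]
  rfl

theorem HasLindbladForm.star_dotProduct_vecMulVec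
    {L : Matrix (Fin n) (Fin n) ℂ →ₗ[ℂ] Matrix (Fin n) (Fin n) ℂ}
    {H : Matrix (Fin n) (Fin n) ℂ} {V : Fin r → Matrix (Fin n) (Fin n) ℂ}
    (hL : HasLindbladForm L H V) {ψ φ : Fin n → ℂ} (h : star φ ⬝ᵥ ψ = 0) :
    star φ ⬝ᵥ (-(L (Matrix.vecMulVec ψ (star ψ)))) *ᵥ φ =
      (∑ k, ‖star φ ⬝ᵥ V k *ᵥ ψ‖ ^ 2 : ℝ) := by
  have h' : star ψ ⬝ᵥ φ = 0 := by
    rw [Matrix.star_dotProduct, h, star_zero]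
  rw [hL.star_dotProduct_mulVec]
  · push_cast
    refine Finset.sum_congr rfl fun k _ => ?_
    rw [star_dotProduct_vecMulVec_mulVec, ← norm_star, ← Matrix.star_dotProduct,
      Matrix.star_mulVec, Matrix.conjTranspose_conjTranspose, Matrix.dotProduct_mulVec]
    push_cast
    rfl
  · rw [Matrix.vecMulVec_mulVec, h']
    simp
  · rw [Matrix.vecMul_vecMulVec, h, zero_smul]

/-- A sum of squared transition amplitudes vanishes exactly when each one does. The right-hand side
no longer mentions `V`. -/
theorem HasLindbladForm.isCommonEigenvector_iff
    {L : Matrix (Fin n) (Fin n) ℂ →ₗ[ℂ] Matrix (Fin n) (Fin n) ℂ}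
    {H : Matrix (Fin n) (Fin n) ℂ} {V : Fin r → Matrix (Fin n) (Fin n) ℂ}
    (hL : HasLindbladForm L H V) {ψ : Fin n → ℂ} :
    IsCommonEigenvector V ψ ↔ ψ ≠ 0 ∧ ∀ φ : Fin n → ℂ, star φ ⬝ᵥ ψ = 0 →
      star φ ⬝ᵥ (-(L (Matrix.vecMulVec ψ (star ψ)))) *ᵥ φ = 0 := by
  refine and_congr_right fun h0 => ?_
  simp only [exists_mulVec_eq_smul_iff h0]
  rw [forall_comm]
  refine forall_congr' fun φ => ?_
  rw [forall_comm]
  refine forall_congr' fun hφ => ?_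
  rw [hL.star_dotProduct_vecMulVec hφ, Complex.ofReal_eq_zero,
    Finset.sum_eq_zero_iff_of_nonneg fun k _ => by positivity]
  simp

theorem vecMul_star_eq_smul_iff {A : Matrix (Fin n) (Fin n) ℂ} {ψ : Fin n → ℂ} :
    (∃ α : ℂ, star ψ ᵥ* A = α • star ψ) ↔ ∃ α : ℂ, Aᴴ *ᵥ ψ = α • ψ := by
  have key (α : ℂ) : star ψ ᵥ* A = α • star ψ ↔ Aᴴ *ᵥ ψ = star α • ψ := by
    rw [← star_inj, Matrix.star_vecMul, star_star, star_smul, star_star]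
  refine ⟨fun ⟨α, h⟩ => ⟨star α, (key α).1 h⟩, fun ⟨α, h⟩ => ⟨star α, (key _).2 ?_⟩⟩
  rwa [star_star]

theorem HasLindbladForm.isCommonLeftEigenvector_iff
    {L : Matrix (Fin n) (Fin n) ℂ →ₗ[ℂ] Matrix (Fin n) (Fin n) ℂ}
    {H : Matrix (Fin n) (Fin n) ℂ} {V : Fin r → Matrix (Fin n) (Fin n) ℂ}
    (hL : HasLindbladForm L H V) {ψ : Fin n → ℂ} :
    IsCommonLeftEigenvector V ψ ↔ ψ ≠ 0 ∧ ∀ φ : Fin n → ℂ, star φ ⬝ᵥ ψ = 0 →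
      star ψ ⬝ᵥ (-(L (Matrix.vecMulVec φ (star φ)))) *ᵥ ψ = 0 := by
  refine and_congr_right fun h0 => ?_
  simp only [vecMul_star_eq_smul_iff, exists_mulVec_eq_smul_iff h0]
  rw [forall_comm]
  refine forall_congr' fun φ => ?_
  rw [forall_comm]
  refine forall_congr' fun hφ => ?_
  have hφ' : star ψ ⬝ᵥ φ = 0 := by
    rw [Matrix.star_dotProduct, hφ, star_zero]
  rw [hL.star_dotProduct_vecMulVec hφ', Complex.ofReal_eq_zero,
    Finset.sum_eq_zero_iff_of_nonneg fun k _ => by positivity]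
  have (k : Fin r) : star φ ⬝ᵥ (V k)ᴴ *ᵥ ψ = star (star ψ ⬝ᵥ V k *ᵥ φ) := by
    rw [Matrix.dotProduct_mulVec, ← Matrix.star_mulVec, Matrix.star_dotProduct]
  simp [this]

/-- The existence of a common eigenvector which is not a common left eigenvector does not depend on
the choice of Lindblad terms. -/
theorem HasLindbladForm.exists_eigenvector_congr {r' : ℕ}
    {L : Matrix (Fin n) (Fin n) ℂ →ₗ[ℂ] Matrix (Fin n) (Fin n) ℂ}
    {H H' : Matrix (Fin n) (Fin n) ℂ} {V : Fin r → Matrix (Fin n) (Fin n) ℂ}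
    {V' : Fin r' → Matrix (Fin n) (Fin n) ℂ}
    (hL : HasLindbladForm L H V) (hL' : HasLindbladForm L H' V')
    (h : ∃ ψ : Fin n → ℂ, IsCommonEigenvector V ψ ∧ ¬ IsCommonLeftEigenvector V ψ) :
    ∃ ψ : Fin n → ℂ, IsCommonEigenvector V' ψ ∧ ¬ IsCommonLeftEigenvector V' ψ := by
  simpa only [hL.isCommonEigenvector_iff, hL.isCommonLeftEigenvector_iff,
    hL'.isCommonEigenvector_iff, hL'.isCommonLeftEigenvector_iff] using h

/-! ### Lindblad flows on density matrices -/

section Flow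

variable {E : Type*} [NormedAddCommGroup E] [NormedSpace ℝ E] [CompleteSpace E]

theorem hasDerivAt_exp_smul_apply (A : E →L[ℝ] E) (x : E) (t : ℝ) :
    HasDerivAt (fun s : ℝ => NormedSpace.exp (s • A) x) (A (NormedSpace.exp (t • A) x)) t :=
  (hasDerivAt_exp_smul_const' (𝕂 := ℝ) A t).clm_apply (hasDerivAt_const t x) |>.congr_deriv
    (by simp)

/-- The flow generated by a linear map on a finite-dimensional space. -/
theorem exists_linear_flow [FiniteDimensional ℝ E] (A : E →ₗ[ℝ] E) :
    ∃ Φ : ℝ → E → E, (∀ t, Continuous (Φ t)) ∧ (∀ x, Φ 0 x = x) ∧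
      (∀ x t, HasDerivAt (fun s => Φ s x) (A (Φ t x)) t) ∧
      ∀ y : ℝ → E, (∀ t, 0 ≤ t → HasDerivWithinAt y (A (y t)) (Ici 0) t) →
        ∀ t, 0 ≤ t → y t = Φ t (y 0) := by
  let B : E →L[ℝ] E := LinearMap.toContinuousLinearMap A
  refine ⟨fun t x => NormedSpace.exp (t • B) x, fun t => (NormedSpace.exp (t • B)).continuous,
    fun x => by simp, fun x t => hasDerivAt_exp_smul_apply B x t, fun y hy t ht => ?_⟩
  refine ODE_solution_unique (v := fun _ => B) (K := ‖B‖₊) (a := 0) (b := t)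
    (f := y) (g := fun s => NormedSpace.exp (s • B) (y 0))
    (fun _ => B.lipschitz) ?_ ?_ ?_ ?_ ?_ ⟨ht, le_rfl⟩
  · exact fun s hs => ((hy s hs.1).continuousWithinAt).mono Icc_subset_Ici_self
  · exact fun s hs => (hy s hs.1).mono (Ici_subset_Ici.2 hs.1)
  · exact fun s _ => (hasDerivAt_exp_smul_apply B (y 0) s).continuousAt.continuousWithinAt
  · exact fun s _ => (hasDerivAt_exp_smul_apply B (y 0) s).hasDerivWithinAt
  · simp

end Flow

/-- The linear flow generated by a linear map on matrices. -/
theorem exists_matrix_flow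
    (G : Matrix (Fin n) (Fin n) ℂ →ₗ[ℂ] Matrix (Fin n) (Fin n) ℂ) :
    ∃ Φ : ℝ → Matrix (Fin n) (Fin n) ℂ → Matrix (Fin n) (Fin n) ℂ,
      (∀ t, Continuous (Φ t)) ∧ (∀ ρ, Φ 0 ρ = ρ) ∧
      (∀ ρ t i j, HasDerivAt (fun s => Φ s ρ i j) (G (Φ t ρ) i j) t) ∧
      ∀ σ : ℝ → Matrix (Fin n) (Fin n) ℂ,
        (∀ t, 0 ≤ t → ∀ i j, HasDerivWithinAt (fun s => σ s i j) (G (σ t) i j) (Ici 0) t) →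
        ∀ t, 0 ≤ t → σ t = Φ t (σ 0) := by
  obtain ⟨Φ, h₁, h₂, h₃, h₄⟩ :=
    exists_linear_flow (E := Fin n → Fin n → ℂ) (G.restrictScalars ℝ)
  refine ⟨Φ, h₁, h₂, fun ρ t i j => hasDerivAt_pi.1 (hasDerivAt_pi.1 (h₃ ρ t) i) j,
    fun σ hσ => h₄ σ fun t ht => ?_⟩
  exact hasDerivWithinAt_pi.2 fun i => hasDerivWithinAt_pi.2 fun j => hσ t ht i j

theorem hasDerivWithinAt_dotProduct_mulVec {ρ : ℝ → Matrix (Fin n) (Fin n) ℂ}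
    {D : Matrix (Fin n) (Fin n) ℂ} {s : Set ℝ} {t : ℝ}
    (h : ∀ i j, HasDerivWithinAt (fun u => ρ u i j) (D i j) s t) (x y : Fin n → ℂ) :
    HasDerivWithinAt (fun u => x ⬝ᵥ ρ u *ᵥ y) (x ⬝ᵥ D *ᵥ y) s t := by
  simp only [dotProduct, Matrix.mulVec]
  exact HasDerivWithinAt.fun_sum fun i _ => (HasDerivWithinAt.fun_sum fun j _ =>
    (h i j).mul_const (y j)).const_mul (x i)

theorem isCompact_unitVectors : IsCompact {x : Fin n → ℂ | star x ⬝ᵥ x = 1} := by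
  refine IsCompact.of_isClosed_subset (isCompact_closedBall (0 : Fin n → ℂ) 1)
    (isClosed_eq (by fun_prop) continuous_const) fun x hx => ?_
  rw [mem_closedBall_zero_iff, pi_norm_le_iff_of_nonneg zero_le_one]
  intro i
  have h : ∑ i, ‖x i‖ ^ 2 = 1 := by
    have : ((∑ i, ‖x i‖ ^ 2 : ℝ) : ℂ) = 1 := by
      rw [← (hx : star x ⬝ᵥ x = 1)]
      push_cast
      exact Finset.sum_congr rfl fun i _ => (Complex.conj_mul' (x i)).symm
    exact_mod_cast this
  have h' := Finset.single_le_sum (fun i _ => sq_nonneg ‖x i‖) (Finset.mem_univ i)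
  rw [h] at h'
  exact (sq_le_one_iff₀ (norm_nonneg _)).1 h'

theorem exists_smul_unitVector {x : Fin n → ℂ} (hx : x ≠ 0) :
    ∃ (a : ℝ) (u : Fin n → ℂ), 0 < a ∧ star u ⬝ᵥ u = 1 ∧ x = (a : ℂ) • u := by
  have h : 0 < star x ⬝ᵥ x := Matrix.dotProduct_star_self_pos_iff.2 hx
  obtain ⟨b, hb⟩ : ∃ b : ℝ, (b : ℂ) = star x ⬝ᵥ x :=
    ⟨_, Complex.ext rfl (Complex.pos_iff.1 h).2⟩
  rw [← hb] at h
  have hb0 : 0 < b := by exact_mod_cast h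
  have ha : 0 < √b := Real.sqrt_pos.2 hb0
  have ha' : (√b : ℂ) ≠ 0 := by exact_mod_cast ha.ne'
  refine ⟨√b, (√b : ℂ)⁻¹ • x, ha, ?_, by rw [smul_inv_smul₀ ha']⟩
  rw [star_smul, smul_dotProduct, dotProduct_smul, ← hb, smul_eq_mul, smul_eq_mul,
    ← Complex.ofReal_inv, RCLike.star_def, Complex.conj_ofReal]
  norm_cast
  field_simp
  rw [Real.sq_sqrt hb0.le]

theorem HasLindbladForm.neg_apply_conjTranspose
    {L : Matrix (Fin n) (Fin n) ℂ →ₗ[ℂ] Matrix (Fin n) (Fin n) ℂ}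
    {H : Matrix (Fin n) (Fin n) ℂ} {V : Fin r → Matrix (Fin n) (Fin n) ℂ}
    (hL : HasLindbladForm L H V) (ρ : Matrix (Fin n) (Fin n) ℂ) :
    (-L) ρᴴ = ((-L) ρ)ᴴ := by
  have hH : Hᴴ = H := hL.1
  rw [LinearMap.neg_apply, LinearMap.neg_apply, hL.2, hL.2]
  simp only [ad, LinearMap.sub_apply, LinearMap.mulLeft_apply, LinearMap.mulRight_apply,
    Matrix.conjTranspose_add, Matrix.conjTranspose_sub, Matrix.conjTranspose_neg,
    Matrix.conjTranspose_smul, Matrix.conjTranspose_sum, Matrix.conjTranspose_mul,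
    Matrix.conjTranspose_conjTranspose, hH]
  congr 1
  · simp only [RCLike.star_def, Complex.conj_I, neg_smul, smul_sub]
    abel
  · refine Finset.sum_congr rfl fun k _ => ?_
    simp only [RCLike.star_def, map_div₀, map_one, map_ofNat, Matrix.mul_assoc, add_comm]

theorem HasLindbladForm.trace_neg_apply
    {L : Matrix (Fin n) (Fin n) ℂ →ₗ[ℂ] Matrix (Fin n) (Fin n) ℂ}
    {H : Matrix (Fin n) (Fin n) ℂ} {V : Fin r → Matrix (Fin n) (Fin n) ℂ}
    (hL : HasLindbladForm L H V) (ρ : Matrix (Fin n) (Fin n) ℂ) :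
    ((-L) ρ).trace = 0 := by
  rw [LinearMap.neg_apply, hL.2]
  simp only [ad, LinearMap.sub_apply, LinearMap.mulLeft_apply, LinearMap.mulRight_apply,
    Matrix.trace_add, Matrix.trace_sub, Matrix.trace_neg, Matrix.trace_smul, Matrix.trace_sum]
  have h (k : Fin r) : (V k * ρ * (V k)ᴴ).trace = ((V k)ᴴ * V k * ρ).trace := by
    rw [Matrix.trace_mul_comm, Matrix.mul_assoc]
  have h' (k : Fin r) : (ρ * ((V k)ᴴ * V k)).trace = ((V k)ᴴ * V k * ρ).trace :=
    Matrix.trace_mul_comm _ _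
  simp only [h, h', Matrix.trace_mul_comm ρ H, sub_self, smul_eq_mul]
  ring_nf
  simp

theorem continuous_re_star_dotProduct_mulVec {X : ℝ → Matrix (Fin n) (Fin n) ℂ}
    (hX : Continuous X) :
    Continuous fun p : ℝ × (Fin n → ℂ) => (star p.2 ⬝ᵥ X p.1 *ᵥ p.2).re :=
  Complex.continuous_re.comp <| continuous_snd.star.dotProduct
    ((hX.comp continuous_fst).matrix_mulVec continuous_snd)

theorem star_dotProduct_mulVec_eq_re {A : Matrix (Fin n) (Fin n) ℂ}
    (hA : A.IsHermitian) (x : Fin n → ℂ) :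
    star x ⬝ᵥ A *ᵥ x = ((star x ⬝ᵥ A *ᵥ x).re : ℂ) := by
  refine (Complex.conj_eq_iff_re.1 ?_).symm
  rw [← RCLike.star_def, ← Matrix.star_dotProduct, Matrix.star_mulVec, hA.eq,
    Matrix.dotProduct_mulVec]

theorem posSemidef_of_re_nonneg {A : Matrix (Fin n) (Fin n) ℂ} (hA : A.IsHermitian)
    (h : ∀ x : Fin n → ℂ, star x ⬝ᵥ x = 1 → 0 ≤ (star x ⬝ᵥ A *ᵥ x).re) : A.PosSemidef := by
  refine .of_dotProduct_mulVec_nonneg hA fun x => ?_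
  rw [star_dotProduct_mulVec_eq_re hA]
  refine Complex.zero_le_real.2 ?_
  rcases eq_or_ne x 0 with rfl | hx
  · simp
  · obtain ⟨a, u, ha, hu, rfl⟩ := exists_smul_unitVector hx
    rw [star_smul, smul_dotProduct, Matrix.mulVec_smul, dotProduct_smul, smul_smul,
      RCLike.star_def, Complex.conj_ofReal, ← Complex.ofReal_mul, smul_eq_mul,
      Complex.re_ofReal_mul]
    exact mul_nonneg (mul_self_nonneg a) (h u hu)

/-- A curve of Hermitian matrices which starts positive definite and whose derivative is positive
along every kernel vector at every positive semidefinite point remains positive. -/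
theorem re_pos_of_hasDerivAt {X D : ℝ → Matrix (Fin n) (Fin n) ℂ} (hX : Continuous X)
    (hherm : ∀ t, 0 ≤ t → (X t).IsHermitian)
    (hD : ∀ t i j, HasDerivAt (fun s => X s i j) (D t i j) t)
    (h0 : ∀ x : Fin n → ℂ, star x ⬝ᵥ x = 1 → 0 < (star x ⬝ᵥ X 0 *ᵥ x).re)
    (hpos : ∀ t, 0 ≤ t → (X t).PosSemidef → ∀ x : Fin n → ℂ, star x ⬝ᵥ x = 1 →
      X t *ᵥ x = 0 → 0 < (star x ⬝ᵥ D t *ᵥ x).re)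
    {T : ℝ} (hT : 0 ≤ T) {x : Fin n → ℂ} (hx : star x ⬝ᵥ x = 1) :
    0 < (star x ⬝ᵥ X T *ᵥ x).re := by
  by_contra! hneg
  have hF := continuous_re_star_dotProduct_mulVec hX
  -- `K` collects the violations of positivity; a point of `K` with least time is the first contact
  -- with the boundary, and the form is positive at all earlier times.
  let K : Set (ℝ × (Fin n → ℂ)) :=
    (Icc 0 T ×ˢ {x | star x ⬝ᵥ x = 1}) ∩ {p | (star p.2 ⬝ᵥ X p.1 *ᵥ p.2).re ≤ 0}
  have hK : IsCompact K :=
    (isCompact_Icc.prod isCompact_unitVectors).inter_right (isClosed_le hF continuous_const)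
  obtain ⟨⟨t₀, x₀⟩, ⟨⟨ht₀, hx₀⟩, hle⟩, hmin⟩ :=
    hK.exists_isMinOn ⟨(T, x), ⟨⟨hT, le_rfl⟩, hx⟩, hneg⟩ continuous_fst.continuousOn
  change star x₀ ⬝ᵥ x₀ = 1 at hx₀
  change (star x₀ ⬝ᵥ X t₀ *ᵥ x₀).re ≤ 0 at hle
  have hlt : 0 < t₀ := by
    refine lt_of_le_of_ne ht₀.1 fun h => ?_
    subst h
    exact absurd hle (not_le.2 (h0 x₀ hx₀))
  have hbefore (t : ℝ) (ht : t ∈ Ico 0 t₀) (y : Fin n → ℂ) (hy : star y ⬝ᵥ y = 1) :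
      0 < (star y ⬝ᵥ X t *ᵥ y).re := by
    by_contra! h
    exact absurd (hmin (show (t, y) ∈ K from ⟨⟨⟨ht.1, ht.2.le.trans ht₀.2⟩, hy⟩, h⟩))
      (not_le.2 ht.2)
  have hev : ∀ᶠ t in 𝓝[<] t₀, t ∈ Ico 0 t₀ := Ico_mem_nhdsLT hlt
  have hpsd : (X t₀).PosSemidef := posSemidef_of_re_nonneg (hherm t₀ ht₀.1) fun y hy => by
    have hc : Continuous fun t => (star y ⬝ᵥ X t *ᵥ y).re :=
      hF.comp (continuous_id.prodMk continuous_const)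
    exact ge_of_tendsto (hc.continuousWithinAt (s := Iio t₀) (x := t₀))
      (hev.mono fun t ht => (hbefore t ht y hy).le)
  have hzero : (star x₀ ⬝ᵥ X t₀ *ᵥ x₀).re = 0 :=
    le_antisymm hle (Complex.nonneg_iff.1 (hpsd.dotProduct_mulVec_nonneg x₀)).1
  have hker : X t₀ *ᵥ x₀ = 0 := by
    rw [← hpsd.dotProduct_mulVec_zero_iff, star_dotProduct_mulVec_eq_re hpsd.1, hzero,
      Complex.ofReal_zero]
  have hderiv : HasDerivAt (fun t => (star x₀ ⬝ᵥ X t *ᵥ x₀).re) (star x₀ ⬝ᵥ D t₀ *ᵥ x₀).re t₀ := by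
    have := hasDerivWithinAt_dotProduct_mulVec (s := univ)
      (fun i j => (hD t₀ i j).hasDerivWithinAt) (star x₀) x₀
    rw [hasDerivWithinAt_univ] at this
    exact Complex.reCLM.hasFDerivAt.comp_hasDerivAt t₀ this
  -- The form is positive before `t₀` and zero at `t₀`, so left difference quotients are negative,
  -- against the positive derivative.
  have hslope := (hasDerivWithinAt_iff_tendsto_slope' (s := Iio t₀) (by simp)).1
    hderiv.hasDerivWithinAt
  refine absurd (le_of_tendsto hslope (hev.mono fun t ht => ?_))
    (not_le.2 (hpos t₀ ht₀.1 hpsd x₀ hx₀ hker))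
  rw [slope_def_field, hzero, sub_zero]
  exact (div_neg_of_pos_of_neg (hbefore t ht x₀ hx₀) (sub_neg.2 ht.2)).le

theorem continuous_of_hasDerivAt_apply {ρ D : ℝ → Matrix (Fin n) (Fin n) ℂ}
    (h : ∀ t i j, HasDerivAt (fun s => ρ s i j) (D t i j) t) : Continuous ρ :=
  continuous_matrix fun i j => continuous_iff_continuousAt.2 fun t => (h t i j).continuousAt

theorem HasLindbladForm.posSemidef_of_hasDerivAt
    {L : Matrix (Fin n) (Fin n) ℂ →ₗ[ℂ] Matrix (Fin n) (Fin n) ℂ}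
    {H : Matrix (Fin n) (Fin n) ℂ} {V : Fin r → Matrix (Fin n) (Fin n) ℂ}
    (hL : HasLindbladForm L H V) {ρ : ℝ → Matrix (Fin n) (Fin n) ℂ}
    (hρ : ∀ t i j, HasDerivAt (fun s => ρ s i j) ((-L) (ρ t) i j) t)
    (hherm : ∀ t, 0 ≤ t → (ρ t).IsHermitian) (h0 : (ρ 0).PosSemidef) {t : ℝ} (ht : 0 ≤ t) :
    (ρ t).PosSemidef := by
  refine posSemidef_of_re_nonneg (hherm t ht) fun x hx => ?_
  -- Adding `ε exp((c+1)t) • 1` makes the initial value positive definite. Since `c` bounds the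
  -- quadratic form of `-L(1)` on unit vectors, the growth rate `c + 1` leaves a strictly positive
  -- surplus on kernel vectors. Then `ε → 0`.
  obtain ⟨c, hc⟩ := isCompact_unitVectors.exists_bound_of_continuousOn
    (f := fun x : Fin n → ℂ => (star x ⬝ᵥ (-L) 1 *ᵥ x).re)
    ((continuous_re_star_dotProduct_mulVec (continuous_const (y := (-L) 1))).comp
      (continuous_const.prodMk continuous_id : Continuous fun x => ((0 : ℝ), x))).continuousOn
  have hone (z : ℂ) (y : Fin n → ℂ) (hy : star y ⬝ᵥ y = 1) :
      star y ⬝ᵥ (z • (1 : Matrix (Fin n) (Fin n) ℂ)) *ᵥ y = z := by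
    rw [Matrix.smul_mulVec, Matrix.one_mulVec, dotProduct_smul, hy, smul_eq_mul, mul_one]
  have key (ε : ℝ) (hε : 0 < ε) :
      0 ≤ (star x ⬝ᵥ ρ t *ᵥ x).re + ε * Real.exp ((c + 1) * t) := by
    have hX (t : ℝ) (i j : Fin n) : HasDerivAt
        (fun s => (ρ s + ((ε * Real.exp ((c + 1) * s) : ℝ) : ℂ) • 1 : Matrix _ _ ℂ) i j)
        (((-L) (ρ t) + (((c + 1) * (ε * Real.exp ((c + 1) * t)) : ℝ) : ℂ) • 1 :
          Matrix _ _ ℂ) i j) t := by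
      have he : HasDerivAt (fun s => ε * Real.exp ((c + 1) * s))
          ((c + 1) * (ε * Real.exp ((c + 1) * t))) t :=
        (((hasDerivAt_id t).const_mul (c + 1)).exp.const_mul ε).congr_deriv (by simp; ring)
      exact (hρ t i j).add (he.ofReal_comp.mul_const ((1 : Matrix (Fin n) (Fin n) ℂ) i j))
    have := re_pos_of_hasDerivAt (continuous_of_hasDerivAt_apply hX) ?_ hX ?_ ?_ ht hx
    · rw [Matrix.add_mulVec, dotProduct_add, hone _ _ hx, Complex.add_re, Complex.ofReal_re] at this
      exact this.le
    · intro s hs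
      refine (hherm s hs).add ?_
      rw [Matrix.IsHermitian, Matrix.conjTranspose_smul, Matrix.conjTranspose_one, RCLike.star_def,
        Complex.conj_ofReal]
    · intro y hy
      rw [Matrix.add_mulVec, dotProduct_add, hone _ _ hy, Complex.add_re, Complex.ofReal_re]
      have := (Complex.nonneg_iff.1 (h0.dotProduct_mulVec_nonneg y)).1
      positivity
    · intro s hs hpsd y hy hker
      set e : ℝ := ε * Real.exp ((c + 1) * s) with he
      have he0 : 0 < e := by positivity
      have hker' : star y ᵥ* (ρ s + (e : ℂ) • 1) = 0 := by
        have := congrArg star hker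
        rwa [Matrix.star_mulVec, hpsd.1.eq, star_zero] at this
      have h1 := hL.star_dotProduct_mulVec hker hker'
      have h2 : 0 ≤ star y ⬝ᵥ (-(L (ρ s + (e : ℂ) • 1))) *ᵥ y := by
        rw [h1]
        exact Finset.sum_nonneg fun k _ => hpsd.dotProduct_mulVec_nonneg _
      have h3 := (Complex.nonneg_iff.1 h2).1
      rw [← LinearMap.neg_apply, map_add, map_smul, Matrix.add_mulVec, Matrix.smul_mulVec,
        dotProduct_add, dotProduct_smul, Complex.add_re, smul_eq_mul, Complex.re_ofReal_mul] at h3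
      rw [Matrix.add_mulVec, dotProduct_add, hone _ _ hy, Complex.add_re, Complex.ofReal_re]
      have h4 := (abs_le.1 (hc y hy)).2
      nlinarith
  have hlim : Tendsto (fun ε : ℝ => (star x ⬝ᵥ ρ t *ᵥ x).re + ε * Real.exp ((c + 1) * t)) (𝓝[>] 0)
      (𝓝 ((star x ⬝ᵥ ρ t *ᵥ x).re + 0 * Real.exp ((c + 1) * t))) :=
    Tendsto.mono_left (Continuous.tendsto (by fun_prop) 0) nhdsWithin_le_nhds
  rw [zero_mul, add_zero] at hlim
  exact ge_of_tendsto hlim (eventually_nhdsWithin_of_forall key)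

/-- Every density matrix is the initial value of a solution of a Lindblad equation; solutions are
given by a flow which is continuous in the initial value. -/
theorem HasLindbladForm.exists_flow
    {L : Matrix (Fin n) (Fin n) ℂ →ₗ[ℂ] Matrix (Fin n) (Fin n) ℂ}
    {H : Matrix (Fin n) (Fin n) ℂ} {V : Fin r → Matrix (Fin n) (Fin n) ℂ}
    (hL : HasLindbladForm L H V) :
    ∃ Φ : ℝ → Matrix (Fin n) (Fin n) ℂ → Matrix (Fin n) (Fin n) ℂ,
      (∀ t, Continuous (Φ t)) ∧ (∀ ρ, Φ 0 ρ = ρ) ∧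
      (∀ ρ ∈ densityMatrices n, IsSolution (-L) fun t => Φ t ρ) ∧
      ∀ σ, IsSolution (-L) σ → ∀ s t, 0 ≤ s → 0 ≤ t → σ (s + t) = Φ t (σ s) := by
  obtain ⟨Φ, h₁, h₂, h₃, h₄⟩ := exists_matrix_flow (-L)
  refine ⟨Φ, h₁, h₂, fun ρ hρ => ⟨fun t ht => ?_, fun t ht i j => (h₃ ρ t i j).hasDerivWithinAt⟩,
    fun σ hσ s t hs ht => ?_⟩
  -- The adjoint curve solves the same equation with the same initial value, so uniqueness makes the
  -- flow Hermitian.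
  · have hherm (t : ℝ) (ht : 0 ≤ t) : (Φ t ρ).IsHermitian := by
      refine (h₄ (fun t => (Φ t ρ)ᴴ) (fun t ht i j => ?_) t ht).trans ?_
      · rw [hL.neg_apply_conjTranspose]
        exact (h₃ ρ t j i).star.hasDerivWithinAt
      · simp only [h₂, hρ.1.1.eq]
    refine ⟨hL.posSemidef_of_hasDerivAt (h₃ ρ) hherm (by rw [h₂]; exact hρ.1) ht, ?_⟩
    have hd (t : ℝ) : HasDerivAt (fun t => (Φ t ρ).trace) 0 t := by
      rw [← hL.trace_neg_apply (Φ t ρ)]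
      exact HasDerivAt.fun_sum fun i _ => h₃ ρ t i i
    have := is_const_of_deriv_eq_zero (fun t => (hd t).differentiableAt) (fun t => (hd t).deriv) t 0
    rw [this, h₂, hρ.2]
  · have := h₄ (fun u => σ (s + u)) (fun u hu i j => ?_) t ht
    · simpa using this
    · have h := (hσ.2 (s + u) (by positivity) i j).scomp u
        (((hasDerivAt_id u).const_add s).hasDerivWithinAt (s := Ici 0))
        (fun v hv => add_nonneg hs hv)
      exact h.congr_deriv (one_smul ℝ _)

/-! ### Pure attractive fixed points yield eigenvectors that are not left eigenvectors -/

theorem HasLindbladForm.add_ad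
    {L : Matrix (Fin n) (Fin n) ℂ →ₗ[ℂ] Matrix (Fin n) (Fin n) ℂ}
    {H₀ H : Matrix (Fin n) (Fin n) ℂ} {V : Fin r → Matrix (Fin n) (Fin n) ℂ}
    (hL : HasLindbladForm L H₀ V) (hH : H.IsHermitian) :
    HasLindbladForm (Complex.I • ad H + L) (H + H₀) V := by
  refine ⟨hH.add hL.1, fun ρ => ?_⟩
  rw [LinearMap.add_apply, neg_add, hL.2, LinearMap.smul_apply, ← add_assoc, ← neg_add, ← smul_add]
  simp only [ad, LinearMap.sub_apply, LinearMap.mulLeft_apply, LinearMap.mulRight_apply, add_mul,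
    mul_add]
  congr 3
  abel

theorem vecMulVec_star_mulVec_self {ψ : Fin n → ℂ} (hψ : star ψ ⬝ᵥ ψ = 1) :
    Matrix.vecMulVec ψ (star ψ) *ᵥ ψ = ψ := by
  rw [Matrix.vecMulVec_mulVec, hψ, op_smul_eq_smul, one_smul]

/-- A pure fixed point of a Lindblad generator is an eigenvector of the Lindblad terms. -/
theorem HasLindbladForm.isCommonEigenvector_of_apply_eq_zero
    {L : Matrix (Fin n) (Fin n) ℂ →ₗ[ℂ] Matrix (Fin n) (Fin n) ℂ}
    {H : Matrix (Fin n) (Fin n) ℂ} {V : Fin r → Matrix (Fin n) (Fin n) ℂ}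
    (hL : HasLindbladForm L H V) {ψ : Fin n → ℂ} (hψ : star ψ ⬝ᵥ ψ = 1)
    (h : (-L) (Matrix.vecMulVec ψ (star ψ)) = 0) : IsCommonEigenvector V ψ := by
  refine hL.isCommonEigenvector_iff.2 ⟨?_, fun φ _ => ?_⟩
  · rintro rfl
    simp at hψ
  · rw [← LinearMap.neg_apply, h, Matrix.zero_mulVec, dotProduct_zero]

/-- If the vector of a pure fixed point is also a left eigenvector of the Lindblad terms, then
its occupation is a conserved quantity. -/
theorem HasLindbladForm.star_dotProduct_apply_mulVec_eq_zero
    {L : Matrix (Fin n) (Fin n) ℂ →ₗ[ℂ] Matrix (Fin n) (Fin n) ℂ}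
    {H : Matrix (Fin n) (Fin n) ℂ} {V : Fin r → Matrix (Fin n) (Fin n) ℂ}
    (hL : HasLindbladForm L H V) {ψ : Fin n → ℂ} (hψ : star ψ ⬝ᵥ ψ = 1)
    (h : (-L) (Matrix.vecMulVec ψ (star ψ)) = 0) (hleft : IsCommonLeftEigenvector V ψ)
    (X : Matrix (Fin n) (Fin n) ℂ) : star ψ ⬝ᵥ (-L) X *ᵥ ψ = 0 := by
  have hψ0 : ψ ≠ 0 := by
    rintro rfl
    simp at hψ
  choose α hα using (hL.isCommonEigenvector_of_apply_eq_zero hψ h).2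
  choose β hβ using fun k => vecMul_star_eq_smul_iff.1 (hleft.2 k)
  have hP := vecMulVec_star_mulVec_self hψ
  -- In the off-diagonal element of the fixed-point equation the dissipative terms produce only
  -- multiples of `ψ`, so what survives is the component of `H ψ` along `φ`.
  obtain ⟨E, hE⟩ : ∃ E : ℂ, H *ᵥ ψ = E • ψ := by
    refine (exists_mulVec_eq_smul_iff hψ0).2 fun φ hφ => ?_
    have hφP (y : Fin n → ℂ) : star φ ⬝ᵥ Matrix.vecMulVec ψ (star ψ) *ᵥ y = 0 := by
      rw [Matrix.vecMulVec_mulVec, op_smul_eq_smul, dotProduct_smul, hφ, smul_zero]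
    have h0 : star φ ⬝ᵥ (-L) (Matrix.vecMulVec ψ (star ψ)) *ᵥ ψ = 0 := by simp [h]
    rw [LinearMap.neg_apply, hL.2] at h0
    simp only [ad, LinearMap.sub_apply, LinearMap.mulLeft_apply, LinearMap.mulRight_apply,
      Matrix.add_mulVec, Matrix.sub_mulVec, Matrix.neg_mulVec, Matrix.smul_mulVec,
      Matrix.sum_mulVec, dotProduct_add, dotProduct_sub, dotProduct_neg, dotProduct_smul,
      dotProduct_sum, ← Matrix.mulVec_mulVec, hP, hα, hβ, Matrix.mulVec_smul, hφ, hφP] at h0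
    simpa using h0
  have hEl (y : Fin n → ℂ) : star ψ ⬝ᵥ H *ᵥ y = star E * (star ψ ⬝ᵥ y) := by
    rw [Matrix.dotProduct_mulVec, ← hL.1.eq, ← Matrix.star_mulVec, hE, star_smul, smul_dotProduct,
      smul_eq_mul]
  have hEr : star E = E := by
    have := hEl ψ
    rwa [hE, dotProduct_smul, hψ, smul_eq_mul, mul_one, mul_one, eq_comm] at this
  have hVl (k : Fin r) (y : Fin n → ℂ) :
      star ψ ⬝ᵥ V k *ᵥ y = star (β k) * (star ψ ⬝ᵥ y) := by
    rw [Matrix.dotProduct_mulVec, ← Matrix.conjTranspose_conjTranspose (V k), ← Matrix.star_mulVec,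
      hβ, star_smul, smul_dotProduct, smul_eq_mul]
  have hVr (k : Fin r) (y : Fin n → ℂ) :
      star ψ ⬝ᵥ (V k)ᴴ *ᵥ y = star (α k) * (star ψ ⬝ᵥ y) := by
    rw [Matrix.dotProduct_mulVec, ← Matrix.star_mulVec,
      hα, star_smul, smul_dotProduct, smul_eq_mul]
  have hαβ (k : Fin r) : star (β k) = α k := by
    have := hVl k ψ
    rwa [hα, dotProduct_smul, hψ, smul_eq_mul, mul_one, mul_one, eq_comm] at this
  rw [LinearMap.neg_apply, hL.2]
  simp only [ad, LinearMap.sub_apply, LinearMap.mulLeft_apply, LinearMap.mulRight_apply,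
    Matrix.add_mulVec, Matrix.sub_mulVec, Matrix.neg_mulVec, Matrix.smul_mulVec,
    Matrix.sum_mulVec, dotProduct_add, dotProduct_sub, dotProduct_neg, dotProduct_smul,
    dotProduct_sum, ← Matrix.mulVec_mulVec, hα, hβ, hE, Matrix.mulVec_smul, hEl, hVl, hVr, hEr,
    smul_eq_mul, sub_self, mul_zero, neg_zero, zero_add]
  refine Finset.sum_eq_zero fun k _ => ?_
  rw [← hαβ k, star_star]
  ring

theorem smul_one_mem_densityMatrices (hn : n ≠ 0) :
    ((n : ℂ)⁻¹ • 1 : Matrix (Fin n) (Fin n) ℂ) ∈ densityMatrices n := by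
  have hn' : (n : ℂ) ≠ 0 := Nat.cast_ne_zero.2 hn
  refine ⟨Matrix.PosSemidef.one.smul ?_, ?_⟩
  · rw [← Complex.ofReal_natCast, ← Complex.ofReal_inv, Complex.zero_le_real]
    positivity
  · rw [Matrix.trace_smul, Matrix.trace_one, Fintype.card_fin, smul_eq_mul, inv_mul_cancel₀ hn']

/-- Started from the maximally mixed state, a conserved population would stay at `1/n`, while
convergence to `ψψ*` forces the limit `1`. -/
theorem HasLindbladForm.not_isCommonLeftEigenvector
    {L : Matrix (Fin n) (Fin n) ℂ →ₗ[ℂ] Matrix (Fin n) (Fin n) ℂ}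
    {H : Matrix (Fin n) (Fin n) ℂ} {V : Fin r → Matrix (Fin n) (Fin n) ℂ}
    (hL : HasLindbladForm L H V) (hn : 2 ≤ n) {ψ : Fin n → ℂ} (hψ : star ψ ⬝ᵥ ψ = 1)
    (h : IsAttractiveFixedPoint (-L) (Matrix.vecMulVec ψ (star ψ))) :
    ¬ IsCommonLeftEigenvector V ψ := by
  intro hleft
  obtain ⟨Φ, -, h₂, h₃, -⟩ := hL.exists_flow
  have hsol := h₃ _ (smul_one_mem_densityMatrices (by omega : n ≠ 0))
  set σ : ℝ → Matrix (Fin n) (Fin n) ℂ := fun t => Φ t ((n : ℂ)⁻¹ • 1)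
  have hd (t : ℝ) (ht : 0 ≤ t) :
      HasDerivWithinAt (fun t => star ψ ⬝ᵥ σ t *ᵥ ψ) 0 (Ici 0) t := by
    rw [← hL.star_dotProduct_apply_mulVec_eq_zero hψ h.2.1 hleft (σ t)]
    exact hasDerivWithinAt_dotProduct_mulVec (hsol.2 t ht) _ _
  have hconst (t : ℝ) (ht : 0 ≤ t) : star ψ ⬝ᵥ σ t *ᵥ ψ = (n : ℂ)⁻¹ := by
    have := constant_of_has_deriv_right_zero (f := fun t => star ψ ⬝ᵥ σ t *ᵥ ψ) (a := 0) (b := t)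
      (fun s hs => (hd s hs.1).continuousWithinAt.mono Icc_subset_Ici_self)
      (fun s hs => (hd s hs.1).mono (Ici_subset_Ici.2 hs.1)) t ⟨ht, le_rfl⟩
    rw [this]
    simp [σ, h₂, Matrix.smul_mulVec, hψ]
  have hlim : Tendsto (fun t => star ψ ⬝ᵥ σ t *ᵥ ψ) atTop
      (𝓝 (star ψ ⬝ᵥ Matrix.vecMulVec ψ (star ψ) *ᵥ ψ)) :=
    (Continuous.tendsto (f := fun A : Matrix (Fin n) (Fin n) ℂ => star ψ ⬝ᵥ A *ᵥ ψ)
      (by fun_prop) _).comp (h.2.2 σ hsol)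
  rw [vecMulVec_star_mulVec_self hψ, hψ] at hlim
  have := tendsto_nhds_unique hlim (tendsto_const_nhds.congr' (f₁ := fun _ => (n : ℂ)⁻¹)
    ((eventually_ge_atTop 0).mono fun t ht => (hconst t ht).symm))
  have h1 : (n : ℂ) = 1 := by rw [← inv_inj, ← this, inv_one]
  have : n = 1 := by exact_mod_cast h1
  omega

/-! ### Construction of the Hamiltonian -/

/-- Shifting Lindblad terms by scalars only changes the Hamiltonian. -/
theorem HasLindbladForm.sub_smul_one
    {L : Matrix (Fin n) (Fin n) ℂ →ₗ[ℂ] Matrix (Fin n) (Fin n) ℂ}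
    {H : Matrix (Fin n) (Fin n) ℂ} {V : Fin r → Matrix (Fin n) (Fin n) ℂ}
    (hL : HasLindbladForm L H V) (α : Fin r → ℂ) :
    HasLindbladForm L (H + ∑ k, (Complex.I / 2) • (star (α k) • V k - α k • (V k)ᴴ))
      fun k => V k - α k • 1 := by
  refine ⟨hL.1.add ?_, fun ρ => ?_⟩
  · rw [Matrix.IsHermitian, Matrix.conjTranspose_sum]
    refine Finset.sum_congr rfl fun k _ => ?_
    have hI : star (Complex.I / 2) = -(Complex.I / 2) := by
      rw [star_div₀, RCLike.star_def, Complex.conj_I, map_ofNat, neg_div]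
    simp only [Matrix.conjTranspose_smul, Matrix.conjTranspose_sub,
      Matrix.conjTranspose_conjTranspose, star_star, hI]
    module
  · rw [hL.2]
    simp only [ad, LinearMap.sub_apply, LinearMap.mulLeft_apply, LinearMap.mulRight_apply, add_mul,
      mul_add, Finset.sum_mul, Finset.mul_sum]
    rw [add_sub_add_comm, ← Finset.sum_sub_distrib, smul_add, neg_add, add_assoc, Finset.smul_sum,
      ← Finset.sum_neg_distrib, ← Finset.sum_add_distrib]
    congr 1
    refine Finset.sum_congr rfl fun k _ => ?_
    simp only [Matrix.conjTranspose_smul, Matrix.conjTranspose_sub, Matrix.conjTranspose_one,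
      sub_mul, mul_sub, smul_mul_assoc, mul_smul_comm, one_mul, mul_one, smul_sub, smul_smul,
      Matrix.mul_assoc]
    have hI : Complex.I * (Complex.I / 2) = -(1 / 2) := by
      rw [← mul_div_assoc, Complex.I_mul_I, neg_div]
    simp only [← mul_assoc, hI]
    module

theorem exists_unitary_mulVec_single [NeZero n] (hn : 2 ≤ n) {x y : Fin n → ℂ}
    (hx : star x ⬝ᵥ x = 1) (hy : star y ⬝ᵥ y = 1) (hxy : star x ⬝ᵥ y = 0) :
    ∃ U : Matrix (Fin n) (Fin n) ℂ, U * Uᴴ = 1 ∧ Uᴴ * U = 1 ∧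
      U *ᵥ Pi.single 0 1 = x ∧ U *ᵥ Pi.single ⟨1, hn⟩ 1 = y := by
  have hin (u v : Fin n → ℂ) : inner ℂ (WithLp.toLp 2 u) (WithLp.toLp 2 v) = star u ⬝ᵥ v := by
    rw [EuclideanSpace.inner_toLp_toLp, dotProduct_comm]
  let w : Fin n → EuclideanSpace ℂ (Fin n) := fun i =>
    if i = 0 then WithLp.toLp 2 x else WithLp.toLp 2 y
  have h10 : (⟨1, hn⟩ : Fin n) ≠ 0 := by simp [Fin.ext_iff]
  obtain ⟨b, hb⟩ := Orthonormal.exists_orthonormalBasis_extension_of_card_eq (𝕜 := ℂ)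
    (E := EuclideanSpace ℂ (Fin n)) (ι := Fin n) (by simp) (v := w) (s := {0, ⟨1, hn⟩}) (by
      rw [orthonormal_iff_ite]
      rintro ⟨i, rfl | rfl⟩ ⟨j, rfl | rfl⟩
      · simp [w, hin, hx, -inner_self_eq_norm_sq_to_K]
      · simp [w, hin, hxy, Subtype.ext_iff, h10, h10.symm]
      · have hyx : star y ⬝ᵥ x = 0 := by rw [Matrix.star_dotProduct, hxy, star_zero]
        simp [w, hin, hyx, Subtype.ext_iff, h10]
      · simp [w, hin, hy, h10, -inner_self_eq_norm_sq_to_K])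
  have hU : (Matrix.of fun i j => b j i : Matrix (Fin n) (Fin n) ℂ)ᴴ *
      (Matrix.of fun i j => b j i) = 1 := by
    ext i j
    rw [Matrix.mul_apply, Matrix.one_apply, ← orthonormal_iff_ite.1 b.orthonormal i j,
      PiLp.inner_apply]
    simp [mul_comm]
  refine ⟨Matrix.of fun i j => b j i, mul_eq_one_comm.1 hU, hU, ?_, ?_⟩
  · ext i
    rw [Matrix.mulVec_single_one, Matrix.col_apply, Matrix.of_apply, hb 0 (by simp)]
    simp [w]
  · ext i
    rw [Matrix.mulVec_single_one, Matrix.col_apply, Matrix.of_apply, hb _ (by simp)]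
    simp [w, h10]

/-- For every Hermitian `M` annihilating `ψ` there is a Hamiltonian `H`, also annihilating `ψ`,
such that a given `v` orthogonal to `ψ` is cyclic for `i H - M` on the complement of `ψ`. -/
theorem exists_cyclic_hamiltonian (hn : 2 ≤ n) {M : Matrix (Fin n) (Fin n) ℂ}
    (hM : M.IsHermitian) {ψ v : Fin n → ℂ} (hψ : star ψ ⬝ᵥ ψ = 1) (hMψ : M *ᵥ ψ = 0)
    (hv : v ≠ 0) (hψv : star ψ ⬝ᵥ v = 0) :
    ∃ H : Matrix (Fin n) (Fin n) ℂ, H.IsHermitian ∧ H *ᵥ ψ = 0 ∧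
      ∀ S : Submodule ℂ (Fin n → ℂ), v ∈ S →
        (∀ x ∈ S, star ψ ⬝ᵥ x = 0 → (Complex.I • H - M) *ᵥ x ∈ S) →
        ∀ x, star ψ ⬝ᵥ x = 0 → x ∈ S := by
  have : NeZero n := ⟨by omega⟩
  obtain ⟨a, y, ha, hy, rfl⟩ := exists_smul_unitVector hv
  have ha' : (a : ℂ) ≠ 0 := Complex.ofReal_ne_zero.2 ha.ne'
  have hψy : star ψ ⬝ᵥ y = 0 := by
    rwa [dotProduct_smul, smul_eq_mul, mul_eq_zero, or_iff_right ha'] at hψv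
  obtain ⟨U, hU, hU', hU0, hU1⟩ := exists_unitary_mulVec_single hn hψ hy hψy
  set M' := Uᴴ * M * U with hM'
  have hM'herm (i j : Fin n) : star (M' i j) = M' j i := by
    have : M'ᴴ = M' := by
      simp only [hM', Matrix.conjTranspose_mul, Matrix.conjTranspose_conjTranspose, hM.eq,
        Matrix.mul_assoc]
    exact congrFun (congrFun this j) i
  have hM'0 (i : Fin n) : M' i 0 = 0 := by
    have : M' *ᵥ Pi.single 0 1 = 0 := by
      rw [hM', ← Matrix.mulVec_mulVec, hU0, ← Matrix.mulVec_mulVec, hMψ, Matrix.mulVec_zero]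
    simpa [Matrix.mulVec_single_one] using congrFun this i
  -- Here `N` plays the role of `iH` in the new basis. Below the diagonal it cancels `M'` up to ones
  -- on the subdiagonal; above, it is forced by skewness. So `N - M'` is upper Hessenberg on indices
  -- `≥ 1`, with the basis vector of index `1` cyclic. Excluding `j = 0` keeps `ψ` decoupled.
  let K : Matrix (Fin n) (Fin n) ℂ := Matrix.of fun i j =>
    M' i j + if (j : ℕ) ≠ 0 ∧ (i : ℕ) = j + 1 then 1 else 0
  let N : Matrix (Fin n) (Fin n) ℂ := Matrix.of fun i j =>
    if j < i then K i j else if i < j then -star (K j i) else 0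
  have hN : Nᴴ = -N := by
    ext i j
    simp only [N, Matrix.conjTranspose_apply, Matrix.of_apply, Matrix.neg_apply]
    rcases lt_trichotomy i j with h | h | h
    · simp [h, h.not_gt]
    · simp [h]
    · simp [h, h.not_gt]
  have hN0 (i : Fin n) : N i 0 = 0 := by
    simp [N, K, hM'0]
  have hNM0 (j : Fin n) (hj : j ≠ 0) : (N - M') 0 j = 0 := by
    have h0 : M' 0 j = 0 := by rw [← hM'herm, hM'0, star_zero]
    simp [N, K, hM'0, h0]
  have hNM1 (i j : Fin n) (h : j < i) (hj : j ≠ 0) :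
      (N - M') i j = if (i : ℕ) = j + 1 then 1 else 0 := by
    simp [N, K, h, hj]
  refine ⟨U * (-Complex.I • N) * Uᴴ, ?_, ?_, fun S hvS hS x hx => ?_⟩
  · simp [Matrix.IsHermitian, Matrix.conjTranspose_mul, hN, Matrix.mul_assoc]
  · rw [← hU0, Matrix.mulVec_mulVec, Matrix.mul_assoc, hU', Matrix.mul_one,
      ← Matrix.mulVec_mulVec]
    have : (-Complex.I • N) *ᵥ Pi.single 0 1 = 0 := by
      ext i
      simp [hN0]
    rw [this, Matrix.mulVec_zero]
  have hsum (z : Fin n → ℂ) : U *ᵥ z = ∑ i, z i • U *ᵥ Pi.single i 1 := by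
    simp_rw [← Matrix.mulVec_smul, ← Matrix.mulVec_sum, ← Pi.single_smul, smul_eq_mul, mul_one,
      Finset.univ_sum_single]
  have hperp (i : Fin n) (hi : i ≠ 0) : star ψ ⬝ᵥ U *ᵥ Pi.single i 1 = 0 := by
    rw [← hU0, Matrix.star_mulVec, ← Matrix.dotProduct_mulVec, Matrix.mulVec_mulVec, hU',
      Matrix.one_mulVec]
    simp [hi]
  have hact (j : Fin n) : (Complex.I • (U * (-Complex.I • N) * Uᴴ) - M) *ᵥ (U *ᵥ Pi.single j 1) =
      ∑ i, (N - M') i j • U *ᵥ Pi.single i 1 := by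
    have h1 : (Complex.I • (U * (-Complex.I • N) * Uᴴ) - M) * U = U * (N - M') := by
      rw [sub_mul, mul_sub, hM', ← Matrix.mul_assoc, ← Matrix.mul_assoc, hU, Matrix.one_mul,
        smul_mul_assoc, Matrix.mul_assoc, hU', Matrix.mul_one, mul_smul_comm, smul_smul]
      simp
    rw [Matrix.mulVec_mulVec, h1, ← Matrix.mulVec_mulVec, hsum]
    simp
  have hmem (m : ℕ) : ∀ i : Fin n, (i : ℕ) = m → i ≠ 0 → U *ᵥ Pi.single i 1 ∈ S := by
    induction m using Nat.strong_induction_on with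
    | _ m ih =>
      intro i hi hi0
      have hi0' : (i : ℕ) ≠ 0 := fun h => hi0 (Fin.ext h)
      obtain rfl | hi1 := eq_or_ne i ⟨1, hn⟩
      · rw [hU1]
        rwa [S.smul_mem_iff ha'] at hvS
      have hi1' : (i : ℕ) ≠ 1 := fun h => hi1 (Fin.ext h)
      let j : Fin n := ⟨i - 1, by omega⟩
      have hj : (j : ℕ) = i - 1 := rfl
      have hj0 : j ≠ 0 := fun h => by
        have := congrArg Fin.val h
        simp [hj] at this
        omega
      -- Applied to basis vector `i - 1`, the operator gives basis vector `i` plus a combination of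
      -- earlier nonzero indices, which are already in `S`.
      have h1 := hS _ (ih (i - 1) (by omega) j hj hj0) (hperp j hj0)
      rw [hact, ← Finset.add_sum_erase _ _ (Finset.mem_univ i)] at h1
      have hc : (N - M') i j = 1 := by
        rw [hNM1 i j (Fin.lt_def.2 (by omega)) hj0, if_pos (by omega)]
      rw [hc, one_smul] at h1
      refine (S.add_mem_iff_left (S.sum_mem fun k hk => ?_)).1 h1
      rcases eq_or_ne k 0 with rfl | hk0
      · rw [hNM0 j hj0, zero_smul]
        exact S.zero_mem
      rcases le_or_gt k j with hkj | hkj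
      · exact S.smul_mem _ (ih k (by rw [Fin.le_def] at hkj; omega) k rfl hk0)
      · have : (k : ℕ) ≠ j + 1 := fun h => (Finset.mem_erase.1 hk).1 (Fin.ext (by omega))
        rw [hNM1 k j hkj hj0, if_neg this, zero_smul]
        exact S.zero_mem
  have hxU : x = U *ᵥ (Uᴴ *ᵥ x) := by rw [Matrix.mulVec_mulVec, hU, Matrix.one_mulVec]
  rw [hxU, hsum]
  refine S.sum_mem fun i _ => ?_
  rcases eq_or_ne i 0 with rfl | hi
  · have : (Uᴴ *ᵥ x) 0 = 0 := by
      rw [← hx, ← hU0, Matrix.star_mulVec, ← Matrix.dotProduct_mulVec]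
      simp
    rw [this, zero_smul]
    exact S.zero_mem
  · exact S.smul_mem _ (hmem i i rfl hi)

/-! ### Convergence to the dark state by LaSalle's principle -/

open scoped MatrixOrder in
-- Density matrices are the image of the Frobenius unit sphere under `B ↦ Bᴴ B`.
theorem isCompact_densityMatrices : IsCompact (densityMatrices n) := by
  have hcpt : IsCompact {B : Matrix (Fin n) (Fin n) ℂ | (Bᴴ * B).trace = 1} := by
    refine IsCompact.of_isClosed_subset (isCompact_univ_pi fun _ : Fin n => isCompact_univ_pi
      fun _ : Fin n => isCompact_closedBall (0 : ℂ) 1)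
      (isClosed_eq (by fun_prop) continuous_const) fun B hB i _ j _ => ?_
    rw [mem_closedBall_zero_iff]
    have h : ∑ j, ∑ i, ‖B i j‖ ^ 2 = 1 := by
      have : ((∑ j, ∑ i, ‖B i j‖ ^ 2 : ℝ) : ℂ) = 1 := by
        rw [← (hB : (Bᴴ * B).trace = 1)]
        push_cast
        exact Finset.sum_congr rfl fun j _ => Finset.sum_congr rfl fun i _ =>
          (Complex.conj_mul' (B i j)).symm
      exact_mod_cast this
    have h₁ := Finset.single_le_sum (f := fun j => ∑ i, ‖B i j‖ ^ 2)
      (fun j _ => Finset.sum_nonneg fun i _ => sq_nonneg ‖B i j‖) (Finset.mem_univ j)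
    have h₂ := Finset.single_le_sum (fun i _ => sq_nonneg ‖B i j‖) (Finset.mem_univ i)
    exact (sq_le_one_iff₀ (norm_nonneg _)).1 (h₂.trans (h₁.trans h.le))
  convert hcpt.image (f := fun B : Matrix (Fin n) (Fin n) ℂ => Bᴴ * B) (by fun_prop)
  ext ρ
  constructor
  · rintro ⟨hρ, htr⟩
    obtain ⟨B, rfl⟩ := CStarAlgebra.nonneg_iff_eq_star_mul_self.1 hρ.nonneg
    exact ⟨B, htr, rfl⟩
  · rintro ⟨B, hB, rfl⟩
    exact ⟨Matrix.posSemidef_conjTranspose_mul_self B, hB⟩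

theorem eq_zero_of_forall_dotProduct {x : Fin n → ℂ} (h : ∀ y : Fin n → ℂ, y ⬝ᵥ x = 0) : x = 0 :=
  dotProduct_star_self_eq_zero.1 (h (star x))

theorem eq_vecMulVec_of_mem_densityMatrices {ρ : Matrix (Fin n) (Fin n) ℂ}
    (hρ : ρ ∈ densityMatrices n) {ψ : Fin n → ℂ} (hψ : star ψ ⬝ᵥ ψ = 1)
    (h : ∀ x : Fin n → ℂ, star ψ ⬝ᵥ x = 0 → ρ *ᵥ x = 0) :
    ρ = Matrix.vecMulVec ψ (star ψ) := by
  have hψ0 : ψ ≠ 0 := by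
    rintro rfl
    simp at hψ
  obtain ⟨c, hc⟩ : ∃ c : ℂ, ρ *ᵥ ψ = c • ψ := by
    refine (exists_mulVec_eq_smul_iff hψ0).2 fun φ hφ => ?_
    rw [Matrix.dotProduct_mulVec, ← hρ.1.1.eq, ← Matrix.star_mulVec, h, star_zero, zero_dotProduct]
    rw [Matrix.star_dotProduct, hφ, star_zero]
  have hρ' : ρ = c • Matrix.vecMulVec ψ (star ψ) := by
    refine Matrix.ext_iff_mulVec.2 fun y => ?_
    have hy : ρ *ᵥ (y - (star ψ ⬝ᵥ y) • ψ) = 0 := h _ (by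
      rw [dotProduct_sub, dotProduct_smul, hψ, smul_eq_mul, mul_one, sub_self])
    rw [Matrix.mulVec_sub, Matrix.mulVec_smul, hc, sub_eq_zero] at hy
    rw [hy, Matrix.smul_mulVec, Matrix.vecMulVec_mulVec, op_smul_eq_smul, smul_comm]
  have htr := hρ.2
  rw [hρ', Matrix.trace_smul, Matrix.trace_vecMulVec, dotProduct_comm, hψ, smul_eq_mul,
    mul_one] at htr
  rw [hρ', htr, one_smul]

theorem vecMulVec_mem_densityMatrices {ψ : Fin n → ℂ} (hψ : star ψ ⬝ᵥ ψ = 1) :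
    Matrix.vecMulVec ψ (star ψ) ∈ densityMatrices n :=
  ⟨Matrix.posSemidef_vecMulVec_self_star ψ, by rw [Matrix.trace_vecMulVec, dotProduct_comm, hψ]⟩

section

variable {L : Matrix (Fin n) (Fin n) ℂ →ₗ[ℂ] Matrix (Fin n) (Fin n) ℂ}
  {H : Matrix (Fin n) (Fin n) ℂ} {V : Fin r → Matrix (Fin n) (Fin n) ℂ}

/-- The quadratic form of `-L(X)` at a kernel vector `x` is a sum of nonnegative jump terms. If it
vanishes, each `(V k)ᴴ x` also lies in the kernel, and all that remains of `-L(X) x` is the asserted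
expression. This makes the common kernel along a trajectory invariant. -/
theorem HasLindbladForm.mulVec_eq_zero (hL : HasLindbladForm L H V)
    {X : Matrix (Fin n) (Fin n) ℂ} (hX : X.PosSemidef) {x : Fin n → ℂ} (h : X *ᵥ x = 0)
    (h' : (-L) X *ᵥ x = 0) :
    X *ᵥ ((Complex.I • H - (1 / 2 : ℂ) • ∑ k, (V k)ᴴ * V k) *ᵥ x) = 0 := by
  have hl : star x ᵥ* X = 0 := by
    have := congrArg star h
    rwa [Matrix.star_mulVec, hX.1.eq, star_zero] at this
  have h1 := hL.star_dotProduct_mulVec h hl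
  rw [← LinearMap.neg_apply, h', dotProduct_zero, eq_comm,
    Finset.sum_eq_zero_iff_of_nonneg fun k _ => hX.dotProduct_mulVec_nonneg _] at h1
  have h2 (k : Fin r) : X *ᵥ ((V k)ᴴ *ᵥ x) = 0 :=
    (hX.dotProduct_mulVec_zero_iff _).1 (h1 k (Finset.mem_univ k))
  rw [LinearMap.neg_apply, hL.2] at h'
  simp only [ad, LinearMap.sub_apply, LinearMap.mulLeft_apply, LinearMap.mulRight_apply,
    Matrix.add_mulVec, Matrix.sub_mulVec, Matrix.neg_mulVec, Matrix.smul_mulVec,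
    Matrix.sum_mulVec, ← Matrix.mulVec_mulVec, h, h2, Matrix.mulVec_zero, zero_sub, zero_add,
    Finset.sum_neg_distrib, smul_neg, neg_neg, ← Finset.smul_sum] at h'
  rw [← h', Matrix.sub_mulVec, Matrix.smul_mulVec, Matrix.smul_mulVec, Matrix.sum_mulVec,
    Matrix.mulVec_sub, Matrix.mulVec_smul, Matrix.mulVec_smul, Matrix.mulVec_sum, sub_eq_add_neg]
  simp only [← Matrix.mulVec_mulVec]

/-- A dark state has no loss term: its population changes only by gains, which are nonnegative on
positive semidefinite `X`. -/
theorem HasLindbladForm.star_dotProduct_apply_mulVec (hL : HasLindbladForm L H V)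
    {ψ : Fin n → ℂ} (hH : H *ᵥ ψ = 0) (hV : ∀ k, V k *ᵥ ψ = 0) (X : Matrix (Fin n) (Fin n) ℂ) :
    star ψ ⬝ᵥ (-L) X *ᵥ ψ = ∑ k, star ((V k)ᴴ *ᵥ ψ) ⬝ᵥ X *ᵥ ((V k)ᴴ *ᵥ ψ) := by
  have hHl (y : Fin n → ℂ) : star ψ ⬝ᵥ H *ᵥ y = 0 := by
    rw [Matrix.dotProduct_mulVec, ← hL.1.eq, ← Matrix.star_mulVec, hH, star_zero, zero_dotProduct]
  have hVl (k : Fin r) (y : Fin n → ℂ) : star ψ ⬝ᵥ (V k)ᴴ *ᵥ y = 0 := by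
    rw [Matrix.dotProduct_mulVec, ← Matrix.star_mulVec, hV, star_zero, zero_dotProduct]
  simp only [← star_dotProduct_star_mulVec]
  rw [LinearMap.neg_apply, hL.2]
  simp only [ad, LinearMap.sub_apply, LinearMap.mulLeft_apply, LinearMap.mulRight_apply,
    Matrix.add_mulVec, Matrix.sub_mulVec, Matrix.neg_mulVec, Matrix.smul_mulVec,
    Matrix.sum_mulVec, dotProduct_add, dotProduct_sub, dotProduct_neg, dotProduct_smul,
    dotProduct_sum, ← Matrix.mulVec_mulVec, hH, hV, hHl, hVl, Matrix.mulVec_zero, dotProduct_zero]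
  simp

theorem HasLindbladForm.neg_apply_vecMulVec (hL : HasLindbladForm L H V)
    {ψ : Fin n → ℂ} (hH : H *ᵥ ψ = 0) (hV : ∀ k, V k *ᵥ ψ = 0) :
    (-L) (Matrix.vecMulVec ψ (star ψ)) = 0 := by
  have hr (B : Matrix (Fin n) (Fin n) ℂ) (hB : B *ᵥ ψ = 0) :
      Matrix.vecMulVec ψ (star ψ) * Bᴴ = 0 := by
    rw [Matrix.vecMulVec_mul, ← Matrix.star_mulVec, hB, star_zero, Matrix.vecMulVec_zero]
  have hl (B : Matrix (Fin n) (Fin n) ℂ) (hB : B *ᵥ ψ = 0) :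
      B * Matrix.vecMulVec ψ (star ψ) = 0 := by
    rw [Matrix.mul_vecMulVec, hB, Matrix.zero_vecMulVec]
  have hr' := hr H hH
  rw [hL.1.eq] at hr'
  rw [LinearMap.neg_apply, hL.2]
  simp only [ad, LinearMap.sub_apply, LinearMap.mulLeft_apply, LinearMap.mulRight_apply,
    ← Matrix.mul_assoc, hr', hl H hH, hr _ (hV _)]
  simp only [Matrix.mul_assoc, hl _ (hV _)]
  simp

/-- A solution with constant occupation of a dark state `ψ` is constant if a state
leaking into `ψ` is cyclic. -/
theorem HasLindbladForm.eq_vecMulVec_of_constant (hL : HasLindbladForm L H V)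
    {ψ : Fin n → ℂ} (hψ : star ψ ⬝ᵥ ψ = 1) (hH : H *ᵥ ψ = 0) (hV : ∀ k, V k *ᵥ ψ = 0)
    (k₀ : Fin r) (hcyc : ∀ S : Submodule ℂ (Fin n → ℂ), (V k₀)ᴴ *ᵥ ψ ∈ S →
        (∀ x ∈ S, star ψ ⬝ᵥ x = 0 →
          (Complex.I • H - (1 / 2 : ℂ) • ∑ k, (V k)ᴴ * V k) *ᵥ x ∈ S) →
        ∀ x, star ψ ⬝ᵥ x = 0 → x ∈ S)
    {σ : ℝ → Matrix (Fin n) (Fin n) ℂ} (hσ : IsSolution (-L) σ) {p : ℂ}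
    (hp : ∀ t, 0 ≤ t → star ψ ⬝ᵥ σ t *ᵥ ψ = p) :
    σ 0 = Matrix.vecMulVec ψ (star ψ) := by
  have hzero {x y : Fin n → ℂ} {c : ℂ} (h : ∀ t, 0 ≤ t → y ⬝ᵥ σ t *ᵥ x = c) (t : ℝ) (ht : 0 ≤ t) :
      y ⬝ᵥ (-L) (σ t) *ᵥ x = 0 :=
    (uniqueDiffOn_Ici (0 : ℝ) t ht).eq_deriv _
      (hasDerivWithinAt_dotProduct_mulVec (hσ.2 t ht) y x)
      ((hasDerivWithinAt_const t (Ici 0) c).congr (fun s hs => h s hs) (h t ht))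
  refine eq_vecMulVec_of_mem_densityMatrices (hσ.1 0 le_rfl) hψ fun x hx => ?_
  -- `S` is the common kernel of all `σ t`; a vector killed at all times is also killed by the
  -- derivative.
  let S : Submodule ℂ (Fin n → ℂ) :=
    { carrier := {x | ∀ t, 0 ≤ t → σ t *ᵥ x = 0}
      add_mem' := fun ha hb t ht => by rw [Matrix.mulVec_add, ha t ht, hb t ht, add_zero]
      zero_mem' := fun t _ => Matrix.mulVec_zero _
      smul_mem' := fun c x hx t ht => by rw [Matrix.mulVec_smul, hx t ht, smul_zero] }
  refine hcyc S (fun t ht => ?_) (fun y hy _ t ht => ?_) x hx 0 le_rfl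
  · have h := hzero hp t ht
    rw [hL.star_dotProduct_apply_mulVec hH hV, Finset.sum_eq_zero_iff_of_nonneg
      fun k _ => (hσ.1 t ht).1.dotProduct_mulVec_nonneg _] at h
    exact ((hσ.1 t ht).1.dotProduct_mulVec_zero_iff _).1 (h k₀ (Finset.mem_univ _))
  · refine hL.mulVec_eq_zero (hσ.1 t ht).1 (hy t ht) (eq_zero_of_forall_dotProduct fun z => ?_)
    exact hzero (c := 0) (fun s hs => by rw [hy s hs, dotProduct_zero]) t ht

theorem HasLindbladForm.isAttractiveFixedPoint (hL : HasLindbladForm L H V)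
    {ψ : Fin n → ℂ} (hψ : star ψ ⬝ᵥ ψ = 1) (hH : H *ᵥ ψ = 0) (hV : ∀ k, V k *ᵥ ψ = 0)
    (k₀ : Fin r) (hcyc : ∀ S : Submodule ℂ (Fin n → ℂ), (V k₀)ᴴ *ᵥ ψ ∈ S →
        (∀ x ∈ S, star ψ ⬝ᵥ x = 0 →
          (Complex.I • H - (1 / 2 : ℂ) • ∑ k, (V k)ᴴ * V k) *ᵥ x ∈ S) →
        ∀ x, star ψ ⬝ᵥ x = 0 → x ∈ S) :
    IsAttractiveFixedPoint (-L) (Matrix.vecMulVec ψ (star ψ)) := by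
  refine ⟨vecMulVec_mem_densityMatrices hψ, hL.neg_apply_vecMulVec hH hV, fun σ hσ => ?_⟩
  obtain ⟨Φ, h₁, h₂, h₃, h₄⟩ := hL.exists_flow
  have hpc : Continuous fun A : Matrix (Fin n) (Fin n) ℂ => (star ψ ⬝ᵥ A *ᵥ ψ).re := by fun_prop
  have hderiv (t : ℝ) (ht : 0 ≤ t) : HasDerivWithinAt (fun t => (star ψ ⬝ᵥ σ t *ᵥ ψ).re)
      (star ψ ⬝ᵥ (-L) (σ t) *ᵥ ψ).re (Ici 0) t :=
    Complex.reCLM.hasFDerivAt.comp_hasDerivWithinAt t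
      (hasDerivWithinAt_dotProduct_mulVec (hσ.2 t ht) _ _)
  have hmono : MonotoneOn (fun t => (star ψ ⬝ᵥ σ t *ᵥ ψ).re) (Ici 0) := by
    refine monotoneOn_of_hasDerivWithinAt_nonneg (convex_Ici 0)
      (fun t ht => (hderiv t ht).continuousWithinAt)
      (fun t ht => (hderiv t (interior_subset ht)).mono interior_subset) fun t ht => ?_
    rw [hL.star_dotProduct_apply_mulVec hH hV]
    exact (Complex.nonneg_iff.1 (Finset.sum_nonneg fun k _ =>
      (hσ.1 t (interior_subset ht)).1.dotProduct_mulVec_nonneg _)).1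
  obtain ⟨p, hp⟩ : ∃ p, Tendsto (fun t => (star ψ ⬝ᵥ σ t *ᵥ ψ).re) atTop (𝓝 p) := by
    have hm : Monotone fun t => (star ψ ⬝ᵥ σ (max t 0) *ᵥ ψ).re := fun s t hst =>
      hmono (le_max_right s 0) (le_max_right t 0) (max_le_max_right 0 hst)
    refine ⟨_, (tendsto_atTop_ciSup hm ?_).congr' ((eventually_ge_atTop 0).mono fun t ht => by
      simp only [max_eq_left ht])⟩
    refine (isCompact_densityMatrices.bddAbove_image hpc.continuousOn).mono ?_
    rintro _ ⟨t, rfl⟩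
    exact mem_image_of_mem _ (hσ.1 _ (le_max_right t 0))
  -- It remains to identify each cluster point `ρ`. By continuity of the flow, the population along
  -- the trajectory of `ρ` is constantly the limit `p`.
  refine isCompact_densityMatrices.tendsto_nhds_of_unique_mapClusterPt
    ((eventually_ge_atTop 0).mono hσ.1) fun ρ hρ hclus => ?_
  rw [← h₂ ρ]
  refine hL.eq_vecMulVec_of_constant hψ hH hV k₀ hcyc (h₃ ρ hρ) (p := p) fun s hs => ?_
  rw [star_dotProduct_mulVec_eq_re ((h₃ ρ hρ).1 s hs).1.1]
  congr 1
  have hc : MapClusterPt (star ψ ⬝ᵥ Φ s ρ *ᵥ ψ).re atTop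
      (fun t => (star ψ ⬝ᵥ Φ s (σ t) *ᵥ ψ).re) :=
    hclus.continuousAt_comp (f := fun A => (star ψ ⬝ᵥ Φ s A *ᵥ ψ).re)
      (hpc.comp (h₁ s)).continuousAt
  have hlim : Tendsto (fun t => (star ψ ⬝ᵥ Φ s (σ t) *ᵥ ψ).re) atTop (𝓝 p) :=
    (hp.comp (tendsto_atTop_add_const_right atTop s tendsto_id)).congr'
      ((eventually_ge_atTop 0).mono fun t ht => by
        simp only [Function.comp_apply, id_eq, h₄ σ hσ t s ht hs])
  have := hc.neBot.mono (inf_le_inf_left _ hlim)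
  exact eq_of_nhds_neBot this

theorem HasLindbladForm.exists_isAttractiveFixedPoint (hL : HasLindbladForm L H V) (hn : 2 ≤ n)
    (h : ∃ ψ : Fin n → ℂ, IsCommonEigenvector V ψ ∧ ¬ IsCommonLeftEigenvector V ψ) :
    ∃ K : Matrix (Fin n) (Fin n) ℂ, K.IsHermitian ∧ ∃ ψ : Fin n → ℂ, star ψ ⬝ᵥ ψ = 1 ∧
      IsAttractiveFixedPoint (-(Complex.I • ad K + L)) (Matrix.vecMulVec ψ (star ψ)) := by
  obtain ⟨ψ', ⟨hψ0, hψ⟩, hleft⟩ := h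
  obtain ⟨a, ψ, ha, hψ1, rfl⟩ := exists_smul_unitVector hψ0
  have ha' : (a : ℂ) ≠ 0 := Complex.ofReal_ne_zero.2 ha.ne'
  choose α hα using hψ
  replace hα (k : Fin r) : V k *ᵥ ψ = α k • ψ := by
    have := hα k
    rw [Matrix.mulVec_smul, smul_comm] at this
    exact smul_right_injective _ ha' this
  have hW (k : Fin r) : (V k - α k • 1) *ᵥ ψ = 0 := by
    rw [Matrix.sub_mulVec, hα, Matrix.smul_mulVec, Matrix.one_mulVec, sub_self]
  obtain ⟨k₀, hk₀⟩ : ∃ k, (V k - α k • 1)ᴴ *ᵥ ψ ≠ 0 := by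
    by_contra! hall
    refine hleft ⟨hψ0, fun k => vecMul_star_eq_smul_iff.2 ⟨star (α k), ?_⟩⟩
    have := hall k
    rw [Matrix.conjTranspose_sub, Matrix.conjTranspose_smul, Matrix.conjTranspose_one,
      Matrix.sub_mulVec, Matrix.smul_mulVec, Matrix.one_mulVec, sub_eq_zero] at this
    rw [Matrix.mulVec_smul, this, smul_comm]
  have hL₁ := hL.sub_smul_one α
  set W : Fin r → Matrix (Fin n) (Fin n) ℂ := fun k => V k - α k • 1
  obtain ⟨K, hK, hKψ, hcyc⟩ := exists_cyclic_hamiltonian hn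
    (M := (1 / 2 : ℂ) • ∑ k, (W k)ᴴ * W k) (v := (W k₀)ᴴ *ᵥ ψ) (by
      simp [Matrix.IsHermitian, Matrix.conjTranspose_smul, Matrix.conjTranspose_sum,
        Matrix.conjTranspose_mul]) hψ1 (by
      rw [Matrix.smul_mulVec, Matrix.sum_mulVec, Finset.sum_eq_zero, smul_zero]
      intro k _
      rw [← Matrix.mulVec_mulVec, hW, Matrix.mulVec_zero]) hk₀ (by
      rw [Matrix.dotProduct_mulVec, ← Matrix.star_mulVec, hW, star_zero, zero_dotProduct])
  -- The control `K - H₁`, with `H₁` the Hamiltonian of the shifted form, makes the total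
  -- Hamiltonian exactly `K`.
  have hL₂ := hL₁.add_ad (hK.sub hL₁.1)
  rw [sub_add_cancel] at hL₂
  exact ⟨_, hK.sub hL₁.1, ψ, hψ1, hL₂.isAttractiveFixedPoint hψ1 hKψ hW k₀ hcyc⟩

end

/-! ### Cooling the reduced system with a constant control -/

theorem conjTranspose_mul_mul_apply (U V : Matrix (Fin n) (Fin n) ℂ) (i j : Fin n) :
    (Uᴴ * V * U) i j = star (U *ᵥ Pi.single i 1) ⬝ᵥ V *ᵥ (U *ᵥ Pi.single j 1) := by
  rw [Matrix.star_mulVec, ← Matrix.dotProduct_mulVec, Matrix.mulVec_mulVec, Matrix.mulVec_mulVec]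
  simp

theorem jMatrix_apply (V : Fin r → Matrix (Fin n) (Fin n) ℂ) (U : Matrix (Fin n) (Fin n) ℂ)
    (i j : Fin n) : jMatrix V U i j = ∑ k, ‖(Uᴴ * V k * U) i j‖ ^ 2 :=
  rfl

theorem jMatrix_smul (V : Fin r → Matrix (Fin n) (Fin n) ℂ) (U : Matrix (Fin n) (Fin n) ℂ) {c : ℂ}
    (hc : ‖c‖ = 1) : jMatrix V (c • U) = jMatrix V U := by
  ext i j
  simp [jMatrix, Matrix.conjTranspose_smul, hc]

theorem exists_norm_eq_one_det_smul_eq_one (hn : n ≠ 0) {U : Matrix (Fin n) (Fin n) ℂ}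
    (hU : Uᴴ * U = 1) : ∃ c : ℂ, ‖c‖ = 1 ∧ c • U ∈ Matrix.specialUnitaryGroup (Fin n) ℂ := by
  have hdet : ‖U.det‖ = 1 := by
    have := congrArg Matrix.det hU
    rw [Matrix.det_mul, Matrix.det_conjTranspose, Matrix.det_one] at this
    have h := congrArg norm this
    rw [norm_mul, norm_star, norm_one] at h
    nlinarith [norm_nonneg U.det]
  obtain ⟨c, hc⟩ := IsAlgClosed.exists_pow_nat_eq (U.det)⁻¹ (Nat.pos_of_ne_zero hn)
  have hc1 : ‖c‖ = 1 := by
    rw [← pow_eq_one_iff_of_nonneg (norm_nonneg c) hn, ← norm_pow, hc, norm_inv, hdet, inv_one]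
  refine ⟨c, hc1, Matrix.mem_specialUnitaryGroup_iff.2 ⟨Matrix.mem_unitaryGroup_iff'.2 ?_, ?_⟩⟩
  · rw [Matrix.star_eq_conjTranspose, Matrix.conjTranspose_smul, smul_mul_smul_comm, hU,
      RCLike.star_def, Complex.conj_mul', hc1]
    simp
  · have : U.det ≠ 0 := norm_ne_zero_iff.1 (by rw [hdet]; exact one_ne_zero)
    rw [Matrix.det_smul, Fintype.card_fin, hc, inv_mul_cancel₀ this]

/-- A common eigenvector which is not a left eigenvector can be completed to a basis in
which it is never left, but is reached from any other basis vector. -/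
theorem exists_cooling_unitary [NeZero n] (hn : 2 ≤ n) {V : Fin r → Matrix (Fin n) (Fin n) ℂ}
    (h : ∃ ψ : Fin n → ℂ, IsCommonEigenvector V ψ ∧ ¬ IsCommonLeftEigenvector V ψ) :
    ∃ U ∈ Matrix.specialUnitaryGroup (Fin n) ℂ,
      (∀ i, i ≠ 0 → jMatrix V U i 0 = 0) ∧ ∀ j, j ≠ 0 → 0 < jMatrix V U 0 j := by
  obtain ⟨ψ', ⟨hψ0, hψ⟩, hleft⟩ := h
  obtain ⟨a, ψ, ha, hψ1, rfl⟩ := exists_smul_unitVector hψ0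
  have ha' : (a : ℂ) ≠ 0 := Complex.ofReal_ne_zero.2 ha.ne'
  choose α hα using hψ
  replace hα (k : Fin r) : V k *ᵥ ψ = α k • ψ := by
    have := hα k
    rw [Matrix.mulVec_smul, smul_comm] at this
    exact smul_right_injective _ ha' this
  obtain ⟨k₀, hk₀⟩ : ∃ k, (V k)ᴴ *ᵥ ψ - star (α k) • ψ ≠ 0 := by
    by_contra! hall
    refine hleft ⟨hψ0, fun k => vecMul_star_eq_smul_iff.2 ⟨star (α k), ?_⟩⟩
    rw [Matrix.mulVec_smul, sub_eq_zero.1 (hall k), smul_comm]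
  -- `y` is the direction of the part of `(V k₀)ᴴ ψ` orthogonal to `ψ`, the states that leak into
  -- `ψ`.
  obtain ⟨b, y, hb, hy, hby⟩ := exists_smul_unitVector hk₀
  have hb' : (b : ℂ) ≠ 0 := Complex.ofReal_ne_zero.2 hb.ne'
  have hψy : star ψ ⬝ᵥ y = 0 := by
    have : star ψ ⬝ᵥ ((b : ℂ) • y) = 0 := by
      rw [← hby, dotProduct_sub, Matrix.dotProduct_mulVec, ← Matrix.star_mulVec, hα, star_smul,
        smul_dotProduct, dotProduct_smul, sub_self]
    rwa [dotProduct_smul, smul_eq_mul, mul_eq_zero, or_iff_right hb'] at this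
  obtain ⟨P, hP, hP', hP0, hP1⟩ := exists_unitary_mulVec_single hn hψ1 hy hψy
  let s : ℝ := √(n - 1 : ℝ)
  have hn1 : (0 : ℝ) < n - 1 := by
    have : (2 : ℝ) ≤ n := by exact_mod_cast hn
    linarith
  have hs : 0 < s := Real.sqrt_pos.2 hn1
  -- `w` is spread evenly over the nonzero indices. Mapping `w` to `y` gives `y` the same nonzero
  -- overlap with every other basis vector, so each of them feeds `ψ`.
  let w : Fin n → ℂ := fun i => if i = 0 then 0 else (s : ℂ)⁻¹
  have hw : star w ⬝ᵥ w = 1 := by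
    have h1 (i : Fin n) : star (w i) * w i =
        ((n : ℂ) - 1)⁻¹ - if i = 0 then ((n : ℂ) - 1)⁻¹ else 0 := by
      by_cases hi : i = 0
      · simp [w, hi]
      · simp only [w, hi, if_false, sub_zero, RCLike.star_def, map_inv₀, Complex.conj_ofReal]
        rw [← mul_inv, ← Complex.ofReal_mul, Real.mul_self_sqrt hn1.le]
        push_cast
        rfl
    have hn2 : (n : ℂ) - 1 ≠ 0 := by exact_mod_cast hn1.ne'
    simp only [dotProduct, Pi.star_apply, h1, Finset.sum_sub_distrib, Finset.sum_const,
      Finset.card_univ, Fintype.card_fin, Finset.sum_ite_eq', Finset.mem_univ, if_true,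
      nsmul_eq_mul]
    field_simp
  obtain ⟨Q, hQ, hQ', hQ0, hQ1⟩ := exists_unitary_mulVec_single (n := n) hn
    (x := Pi.single 0 1) (y := w) (by simp) hw (by simp [w])
  have hU : (P * Qᴴ)ᴴ * (P * Qᴴ) = 1 := by
    rw [Matrix.conjTranspose_mul, Matrix.conjTranspose_conjTranspose, Matrix.mul_assoc,
      ← Matrix.mul_assoc Pᴴ, hP', Matrix.one_mul, hQ]
  obtain ⟨c, hc, hcU⟩ := exists_norm_eq_one_det_smul_eq_one (by omega) hU
  set U := P * Qᴴ with hUdef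
  have hU0 : U *ᵥ Pi.single 0 1 = ψ := by
    nth_rw 1 [← hQ0]
    rw [Matrix.mulVec_mulVec, hUdef, Matrix.mul_assoc, hQ', Matrix.mul_one, hP0]
  have hUw : U *ᵥ w = y := by
    rw [← hQ1, Matrix.mulVec_mulVec, hUdef, Matrix.mul_assoc, hQ', Matrix.mul_one, hP1]
  have hinner (u x : Fin n → ℂ) : star (U *ᵥ u) ⬝ᵥ U *ᵥ x = star u ⬝ᵥ x := by
    rw [Matrix.star_mulVec, ← Matrix.dotProduct_mulVec, Matrix.mulVec_mulVec, hU, Matrix.one_mulVec]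
  refine ⟨c • U, hcU, fun i hi => ?_, fun j hj => ?_⟩
  · rw [jMatrix_smul _ _ hc, jMatrix_apply]
    refine Finset.sum_eq_zero fun k _ => ?_
    rw [conjTranspose_mul_mul_apply, hU0, hα, dotProduct_smul, ← hU0, hinner]
    simp [hi]
  · rw [jMatrix_smul _ _ hc]
    refine (Finset.sum_pos_iff_of_nonneg fun k _ => by positivity).2 ⟨k₀, Finset.mem_univ _, ?_⟩
    have hne : (Uᴴ * V k₀ * U) 0 j ≠ 0 := by
      rw [conjTranspose_mul_mul_apply, hU0, Matrix.dotProduct_mulVec,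
        ← Matrix.conjTranspose_conjTranspose (V k₀), ← Matrix.star_mulVec,
        sub_eq_iff_eq_add.1 hby, star_add, add_dotProduct, star_smul, smul_dotProduct, ← hUw,
        hinner, star_smul, smul_dotProduct, ← hU0, hinner]
      simp [hj, w, hb', hs.ne']
    positivity

theorem inducedField_apply_of_ne (V : Fin r → Matrix (Fin n) (Fin n) ℂ)
    (U : Matrix (Fin n) (Fin n) ℂ) {i j : Fin n} (h : i ≠ j) :
    inducedField V U i j = jMatrix V U i j := by
  simp [inducedField, h]

theorem inducedField_apply_self (V : Fin r → Matrix (Fin n) (Fin n) ℂ)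
    (U : Matrix (Fin n) (Fin n) ℂ) (i : Fin n) :
    inducedField V U i i = jMatrix V U i i - ∑ k, jMatrix V U k i := by
  simp [inducedField, Matrix.mulVec, dotProduct]

theorem jMatrix_nonneg (V : Fin r → Matrix (Fin n) (Fin n) ℂ)
    (U : Matrix (Fin n) (Fin n) ℂ) (i j : Fin n) : 0 ≤ jMatrix V U i j := by
  rw [jMatrix_apply]
  positivity

theorem sum_inducedField (V : Fin r → Matrix (Fin n) (Fin n) ℂ)
    (U : Matrix (Fin n) (Fin n) ℂ) (j : Fin n) : ∑ i, inducedField V U i j = 0 := by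
  simp [inducedField, Matrix.mulVec, dotProduct, Matrix.diagonal_apply]

/-- The flow of a generator of a Markov process preserves the simplex. -/
theorem exists_hasDerivAt_mem_stdSimplex {M : Matrix (Fin n) (Fin n) ℝ}
    (hoff : ∀ i j, i ≠ j → 0 ≤ M i j) (hcol : ∀ j, ∑ i, M i j = 0) {x : Fin n → ℝ}
    (hx : x ∈ stdSimplex ℝ (Fin n)) :
    ∃ l : ℝ → Fin n → ℝ, l 0 = x ∧ (∀ t, HasDerivAt l (M *ᵥ l t) t) ∧
      ∀ t, 0 ≤ t → l t ∈ stdSimplex ℝ (Fin n) := by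
  -- The shift by `c` makes all entries of `M + c • 1` nonnegative, so the exponential series of `t
  -- • B` preserves nonnegativity for `t ≥ 0`; the scalar `exp(-ct)` undoes the shift.
  let c : ℝ := ∑ i, |M i i|
  have hB (i j : Fin n) : 0 ≤ (M + c • 1) i j := by
    by_cases h : i = j
    · subst h
      have h1 : |M i i| ≤ c :=
        Finset.single_le_sum (f := fun i => |M i i|) (fun i _ => abs_nonneg _) (Finset.mem_univ i)
      have h2 := neg_abs_le (M i i)
      simp only [Matrix.add_apply, Matrix.smul_apply, Matrix.one_apply_eq, smul_eq_mul, mul_one]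
      linarith
    · simpa [h] using hoff i j h
  let B : (Fin n → ℝ) →L[ℝ] (Fin n → ℝ) := LinearMap.toContinuousLinearMap (M + c • 1).mulVecLin
  have hBapp (y : Fin n → ℝ) : B y = M *ᵥ y + c • y := by
    simp [B]
  have hBnn (y : Fin n → ℝ) (hy : ∀ i, 0 ≤ y i) (i : Fin n) :
      0 ≤ B y i :=
    show 0 ≤ ∑ j, (M + c • 1) i j * y j from Finset.sum_nonneg fun j _ => mul_nonneg (hB i j) (hy j)
  have hderiv (t : ℝ) : HasDerivAt (fun t => Real.exp (-c * t) • NormedSpace.exp (t • B) x)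
      (M *ᵥ (Real.exp (-c * t) • NormedSpace.exp (t • B) x)) t := by
    refine (((hasDerivAt_id t).const_mul (-c)).exp.smul
      (hasDerivAt_exp_smul_apply B x t)).congr_deriv ?_
    rw [hBapp, Matrix.mulVec_smul]
    simp only [id]
    module
  refine ⟨_, by simp, hderiv, fun t ht => ⟨fun i => ?_, ?_⟩⟩
  · refine mul_nonneg (Real.exp_pos _).le ?_
    have hpow (k : ℕ) (y : Fin n → ℝ) (hy : ∀ i, 0 ≤ y i) (i : Fin n) : 0 ≤ ((t • B) ^ k) y i := by
      induction k generalizing i with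
      | zero => simpa using hy i
      | succ k ih =>
        rw [pow_succ', mul_apply_eq_comp]
        exact mul_nonneg ht (hBnn _ ih i)
    have hsum := NormedSpace.exp_series_hasSum_exp' (𝕂 := ℝ) (t • B)
    have hsum' := (hsum.mapL (ContinuousLinearMap.apply ℝ (Fin n → ℝ) x)).mapL
      (ContinuousLinearMap.proj (R := ℝ) (φ := fun _ : Fin n => ℝ) i)
    exact hsum'.nonneg fun k => mul_nonneg (by positivity) (hpow k x hx.1 i)
  · have hd (t : ℝ) : HasDerivAt
        (fun t => ∑ i, (Real.exp (-c * t) • NormedSpace.exp (t • B) x) i) 0 t := by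
      refine (HasDerivAt.fun_sum fun i _ => hasDerivAt_pi.1 (hderiv t) i).congr_deriv ?_
      simp only [Matrix.mulVec, dotProduct]
      rw [Finset.sum_comm]
      simp only [← Finset.sum_mul, hcol, zero_mul, Finset.sum_const_zero]
    have := is_const_of_deriv_eq_zero (fun t => (hd t).differentiableAt) (fun t => (hd t).deriv) t 0
    rw [this]
    simpa using hx.2

theorem exists_isReducedSolution_tendsto [NeZero n] (hn : 2 ≤ n)
    {V : Fin r → Matrix (Fin n) (Fin n) ℂ}
    (h : ∃ ψ : Fin n → ℂ, IsCommonEigenvector V ψ ∧ ¬ IsCommonLeftEigenvector V ψ)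
    {x : Fin n → ℝ} (hx : x ∈ stdSimplex ℝ (Fin n)) :
    ∃ l : ℝ → Fin n → ℝ, IsReducedSolution V (Ici 0) l ∧ l 0 = x ∧
      Tendsto l atTop (𝓝 (Pi.single 0 1)) := by
  obtain ⟨U, hU, hout, hin⟩ := exists_cooling_unitary hn h
  obtain ⟨l, hl0, hl, hmem⟩ := exists_hasDerivAt_mem_stdSimplex (M := inducedField V U)
    (fun i j hij => by rw [inducedField_apply_of_ne V U hij]; exact jMatrix_nonneg V U i j)
    (sum_inducedField V U) hx
  have hcont : Continuous l := continuous_iff_continuousAt.2 fun t => (hl t).continuousAt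
  refine ⟨l, ⟨hmem, fun S _ _ => ?_, fun _ => ⟨U, hU⟩, fun i j => measurable_const,
    Eventually.of_forall hl⟩, hl0, ?_⟩
  · have : ContDiff ℝ 1 l := by
      refine contDiff_one_iff_deriv.2 ⟨fun t => (hl t).differentiableAt, ?_⟩
      rw [funext fun t => (hl t).deriv]
      fun_prop
    exact this.contDiffOn.absolutelyContinuousOnInterval
  obtain ⟨c, hc0, hc⟩ : ∃ c : ℝ, 0 < c ∧ ∀ j, j ≠ 0 → c ≤ jMatrix V U 0 j := by
    obtain ⟨j, hj, hmin⟩ := Finset.exists_min_image (Finset.univ.erase (0 : Fin n))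
      (fun j => jMatrix V U 0 j) ⟨⟨1, hn⟩, by simp [Fin.ext_iff]⟩
    exact ⟨_, hin j (Finset.ne_of_mem_erase hj), fun i hi => hmin i (by simp [hi])⟩
  have hsum (t : ℝ) (ht : 0 ≤ t) : ∑ j ∈ Finset.univ.erase 0, l t j = 1 - l t 0 := by
    rw [eq_sub_iff_add_eq, Finset.sum_erase_add _ _ (Finset.mem_univ _), (hmem t ht).2]
  have hderiv (t : ℝ) (ht : 0 ≤ t) : c * (1 - l t 0) ≤ (inducedField V U *ᵥ l t) 0 := by
    have h00 : inducedField V U 0 0 = 0 := by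
      rw [inducedField_apply_self, ← Finset.sum_erase_add _ _ (Finset.mem_univ 0),
        Finset.sum_eq_zero fun i hi => hout i (Finset.ne_of_mem_erase hi), zero_add, sub_self]
    rw [Matrix.mulVec, dotProduct, ← Finset.sum_erase_add _ _ (Finset.mem_univ 0), h00, zero_mul,
      add_zero, ← hsum t ht, Finset.mul_sum]
    refine Finset.sum_le_sum fun j hj => ?_
    have hj := Finset.ne_of_mem_erase hj
    rw [inducedField_apply_of_ne _ _ hj.symm]
    exact mul_le_mul_of_nonneg_right (hc j hj) ((hmem t ht).1 j)
  have hg (t : ℝ) : HasDerivAt (fun t => Real.exp (c * t) * (1 - l t 0))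
      (Real.exp (c * t) * (c * (1 - l t 0) - (inducedField V U *ᵥ l t) 0)) t := by
    refine (((hasDerivAt_id t).const_mul c).exp.mul
      ((hasDerivAt_pi.1 (hl t) 0).const_sub 1)).congr_deriv ?_
    simp only [id]
    ring
  -- Gronwall with an integrating factor: the mass outside the first vertex decays at least at the
  -- smallest inflow rate `c`.
  have hanti : AntitoneOn (fun t => Real.exp (c * t) * (1 - l t 0)) (Ici 0) := by
    refine antitoneOn_of_hasDerivWithinAt_nonpos (convex_Ici 0)
      (fun t _ => (hg t).continuousAt.continuousWithinAt) (fun t _ => (hg t).hasDerivWithinAt)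
      fun t ht => ?_
    exact mul_nonpos_of_nonneg_of_nonpos (Real.exp_pos _).le
      (sub_nonpos.2 (hderiv t (interior_subset ht)))
  have hdecay (t : ℝ) (ht : 0 ≤ t) : 1 - l t 0 ≤ (1 - l 0 0) * Real.exp (-(c * t)) := by
    have := hanti self_mem_Ici ht ht
    simp only [mul_zero, Real.exp_zero, one_mul] at this
    rw [Real.exp_neg, ← div_eq_mul_inv, le_div_iff₀ (Real.exp_pos _), mul_comm]
    exact this
  have hlim : Tendsto (fun t => (1 - l 0 0) * Real.exp (-(c * t))) atTop (𝓝 0) := by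
    have := (Real.tendsto_exp_neg_atTop_nhds_zero.comp
      (tendsto_id.const_mul_atTop hc0)).const_mul (1 - l 0 0)
    simpa using this
  refine tendsto_pi_nhds.2 fun j => ?_
  rw [tendsto_iff_dist_tendsto_zero]
  refine squeeze_zero' (Eventually.of_forall fun t => dist_nonneg)
    ((eventually_ge_atTop 0).mono fun t ht => le_trans ?_ (hdecay t ht)) hlim
  have hle : l t 0 ≤ 1 := by
    rw [← (hmem t ht).2]
    exact Finset.single_le_sum (fun i _ => (hmem t ht).1 i) (Finset.mem_univ 0)
  by_cases hj : j = 0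
  · subst hj
    rw [Pi.single_eq_same, Real.dist_eq, abs_sub_comm, abs_of_nonneg (by linarith)]
  · rw [Pi.single_eq_of_ne hj, Real.dist_0_eq_abs, abs_of_nonneg ((hmem t ht).1 j), ← hsum t ht]
    exact Finset.single_le_sum (fun i _ => (hmem t ht).1 i)
      (Finset.mem_erase.2 ⟨hj, Finset.mem_univ j⟩)

/-! ### Uniform bound of inflow by outflow -/

/-- `S` factors through the range of `T`, which is finite-dimensional, and the factor is
automatically bounded. -/
theorem exists_norm_le_mul_norm_of_ker_le {E F G : Type*} [NormedAddCommGroup E]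
    [NormedSpace ℂ E] [NormedAddCommGroup F] [NormedSpace ℂ F] [FiniteDimensional ℂ F]
    [NormedAddCommGroup G] [NormedSpace ℂ G] (T : E →ₗ[ℂ] F) (S : E →ₗ[ℂ] G)
    (h : ∀ x, T x = 0 → S x = 0) : ∃ C : ℝ, 0 ≤ C ∧ ∀ x, ‖S x‖ ≤ C * ‖T x‖ := by
  obtain ⟨g, hg⟩ := T.rangeRestrict.exists_rightInverse_of_surjective T.range_rangeRestrict
  let R := LinearMap.toContinuousLinearMap (S ∘ₗ g)
  refine ⟨‖R‖, R.opNorm_nonneg, fun x => ?_⟩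
  have hx : T.rangeRestrict (g (T.rangeRestrict x)) = T.rangeRestrict x := LinearMap.congr_fun hg _
  have hS : S (x - g (T.rangeRestrict x)) = 0 := h _ (by
    have : T (g (T.rangeRestrict x)) = T x := congrArg Subtype.val hx
    rw [map_sub, this, sub_self])
  rw [map_sub, sub_eq_zero] at hS
  rw [hS]
  exact R.le_opNorm (T.rangeRestrict x)

section

variable {E : Type*} [NormedAddCommGroup E] [InnerProductSpace ℂ E]

local notation "⟪" x ", " y "⟫" => inner ℂ x y

theorem norm_sub_inner_smul_le {ψ : E} (hψ : ‖ψ‖ = 1) (x : E) (a : ℂ) :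
    ‖x - ⟪ψ, x⟫ • ψ‖ ≤ ‖x - a • ψ‖ := by
  have h : ⟪x - ⟪ψ, x⟫ • ψ, (⟪ψ, x⟫ - a) • ψ⟫ = 0 := by
    rw [inner_smul_right, inner_sub_left, inner_smul_left, inner_self_eq_norm_sq_to_K, hψ,
      inner_conj_symm]
    simp
  have h' := norm_add_sq_eq_norm_sq_add_norm_sq_of_inner_eq_zero _ _ h
  rw [sub_smul, sub_add_sub_cancel] at h'
  nlinarith [norm_nonneg (x - a • ψ), norm_nonneg (x - ⟪ψ, x⟫ • ψ),
    mul_self_nonneg ‖⟪ψ, x⟫ • ψ - a • ψ‖]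

variable [FiniteDimensional ℂ E]

/-- If every common eigenvector of finitely many operators is a common eigenvector of their
adjoints, then the variances of the adjoints are controlled by those of the operators. -/
theorem exists_sum_norm_adjoint_sq_le {κ : Type*} [Fintype κ] (A B : κ → E →ₗ[ℂ] E)
    (hAB : ∀ k x y, ⟪B k x, y⟫ = ⟪x, A k y⟫)
    (h : ∀ ψ : E, ψ ≠ 0 → (∀ k, ∃ α : ℂ, A k ψ = α • ψ) → ∀ k, ∃ β : ℂ, B k ψ = β • ψ) :
    ∃ C : ℝ, 0 ≤ C ∧ ∀ ψ : E, ‖ψ‖ = 1 →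
      ∑ k, ‖B k ψ - ⟪ψ, B k ψ⟫ • ψ‖ ^ 2 ≤ C * ∑ k, ‖A k ψ - ⟪ψ, A k ψ⟫ • ψ‖ ^ 2 := by
  set f : E → ℝ := fun ψ => ∑ k, ‖B k ψ - ⟪ψ, B k ψ⟫ • ψ‖ ^ 2 with hf
  set g : E → ℝ := fun ψ => ∑ k, ‖A k ψ - ⟪ψ, A k ψ⟫ • ψ‖ ^ 2 with hg
  have hAc (k : κ) : Continuous (A k) := (A k).continuous_of_finiteDimensional
  have hBc (k : κ) : Continuous (B k) := (B k).continuous_of_finiteDimensional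
  have hfc : Continuous f := by fun_prop
  have hgc : Continuous g := by fun_prop
  have hg0 (ψ : E) : 0 ≤ g ψ := Finset.sum_nonneg fun k _ => by positivity
  have hf0 (ψ : E) : 0 ≤ f ψ := Finset.sum_nonneg fun k _ => by positivity
  have : ProperSpace E := FiniteDimensional.proper ℂ E
  suffices ∃ C : ℝ, 0 ≤ C ∧ ∀ ψ ∈ Metric.sphere (0 : E) 1, ‖ψ‖ = 1 → f ψ ≤ C * g ψ by
    obtain ⟨C, hC, hle⟩ := this
    exact ⟨C, hC, fun ψ hψ => hle ψ (by simpa using hψ) hψ⟩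
  -- Compactness of the sphere reduces the claim to a bound near each `ψ₀`. Where `g ψ₀ > 0`
  -- continuity is enough; the delicate points are the common eigenvectors, where `g` vanishes.
  refine (isCompact_sphere (0 : E) 1).induction_on (p := fun s => ∃ C : ℝ, 0 ≤ C ∧
    ∀ ψ ∈ s, ‖ψ‖ = 1 → f ψ ≤ C * g ψ) ⟨0, le_rfl, by simp⟩ ?_ ?_ ?_
  · rintro s t hst ⟨C, hC, hle⟩
    exact ⟨C, hC, fun ψ hψ => hle ψ (hst hψ)⟩
  · rintro s t ⟨C, hC, hle⟩ ⟨D, hD, hle'⟩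
    refine ⟨max C D, le_max_of_le_left hC, fun ψ hψ h1 => ?_⟩
    rcases hψ with hψ | hψ
    · exact (hle ψ hψ h1).trans (mul_le_mul_of_nonneg_right (le_max_left _ _) (hg0 ψ))
    · exact (hle' ψ hψ h1).trans (mul_le_mul_of_nonneg_right (le_max_right _ _) (hg0 ψ))
  intro ψ₀ hψ₀
  have hψ₀ : ‖ψ₀‖ = 1 := by simpa using hψ₀
  suffices ∃ C : ℝ, 0 ≤ C ∧ ∀ᶠ ψ in 𝓝 ψ₀, ‖ψ‖ = 1 → f ψ ≤ C * g ψ by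
    obtain ⟨C, hC, hev⟩ := this
    exact ⟨_, mem_nhdsWithin_of_mem_nhds hev, C, hC, fun ψ hψ => hψ⟩
  rcases (hg0 ψ₀).lt_or_eq with hpos | hzero
  · refine ⟨(f ψ₀ + 1) / (g ψ₀ / 2), by have := hf0 ψ₀; positivity, ?_⟩
    filter_upwards [hfc.continuousAt.eventually_lt_const (lt_add_one (f ψ₀)),
      hgc.continuousAt.eventually_const_lt (half_lt_self hpos)] with ψ h1 h2 _
    have h3 := hf0 ψ₀
    rw [div_mul_eq_mul_div, le_div_iff₀ (by positivity)]
    exact mul_le_mul h1.le h2.le (by positivity) (by positivity)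
  have hψ0 : ψ₀ ≠ 0 := norm_ne_zero_iff.1 (by rw [hψ₀]; exact one_ne_zero)
  set α : κ → ℂ := fun k => ⟪ψ₀, A k ψ₀⟫ with hα
  have hAψ (k : κ) : A k ψ₀ = α k • ψ₀ := by
    have := (Finset.sum_eq_zero_iff_of_nonneg fun k _ => by positivity).1 hzero.symm k
      (Finset.mem_univ k)
    exact sub_eq_zero.1 (norm_eq_zero.1 (pow_eq_zero_iff two_ne_zero |>.1 this))
  have hBψ (ψ : E) (hψ : ∀ k, A k ψ = α k • ψ) (k : κ) :
      B k ψ = (starRingEnd ℂ) (α k) • ψ := by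
    rcases eq_or_ne ψ 0 with rfl | hne
    · simp
    obtain ⟨β, hβ⟩ := h ψ hne (fun k => ⟨_, hψ k⟩) k
    have h1 := hAB k ψ ψ
    rw [hβ, hψ, inner_smul_left, inner_smul_right] at h1
    have h2 : (starRingEnd ℂ) β = α k := mul_right_cancel₀ (inner_self_ne_zero.2 hne) h1
    rw [hβ, ← h2, Complex.conj_conj]
  -- By hypothesis the joint eigenspace of the `A k` at `α` lies in that of the `B k` at the
  -- conjugate eigenvalues, which gives a linear estimate with frozen eigenvalues.
  obtain ⟨C, hC, hle⟩ := exists_norm_le_mul_norm_of_ker_le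
    (LinearMap.pi fun k => A k - α k • LinearMap.id)
    (LinearMap.pi fun k => B k - (starRingEnd ℂ) (α k) • LinearMap.id) (fun x hx => by
      have hx' (k : κ) : A k x = α k • x := sub_eq_zero.1 (congrFun hx k)
      ext k
      simp [hBψ x hx' k])
  refine ⟨Fintype.card κ * (C ^ 2 * 6), by positivity, ?_⟩
  have hev : ∀ᶠ ψ in 𝓝 ψ₀, 1 / 2 < ‖⟪ψ₀, ψ⟫‖ ^ 2 := by
    have hc : Continuous fun ψ => ‖⟪ψ₀, ψ⟫‖ ^ 2 := by fun_prop
    refine hc.continuousAt.eventually_const_lt ?_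
    simp only [inner_self_eq_norm_sq_to_K, hψ₀]
    norm_num
  filter_upwards [hev] with ψ hov hψ
  have hT : ‖(LinearMap.pi fun k => A k - α k • LinearMap.id : E →ₗ[ℂ] κ → E) ψ‖ ^ 2 ≤
      6 * g ψ := by
    -- Replacing the mean `z` by the frozen `α k` costs a bounded factor: pairing with `ψ₀`, whose
    -- squared overlap with `ψ` exceeds `1/2`, gives `‖α k - z‖² ≤ 2‖A k ψ - z ψ‖²`, and `6 = 2(1 +
    -- 2)`.
    have hk (k : κ) : ‖A k ψ - α k • ψ‖ ^ 2 ≤ 6 * ‖A k ψ - ⟪ψ, A k ψ⟫ • ψ‖ ^ 2 := by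
      set z := ⟪ψ, A k ψ⟫
      have h1 : ⟪ψ₀, A k ψ - z • ψ⟫ = (α k - z) * ⟪ψ₀, ψ⟫ := by
        rw [inner_sub_right, ← hAB, hBψ ψ₀ hAψ, inner_smul_left, inner_smul_right,
          Complex.conj_conj, sub_mul]
      have h2 : ‖α k - z‖ * ‖⟪ψ₀, ψ⟫‖ ≤ ‖A k ψ - z • ψ‖ := by
        rw [← norm_mul, ← h1]
        refine (norm_inner_le_norm (𝕜 := ℂ) ψ₀ (A k ψ - z • ψ)).trans_eq ?_
        rw [hψ₀, one_mul]
      have h3 : ‖α k - z‖ ^ 2 ≤ 2 * ‖A k ψ - z • ψ‖ ^ 2 := by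
        have := pow_le_pow_left₀ (by positivity) h2 2
        rw [mul_pow] at this
        nlinarith [sq_nonneg ‖α k - z‖]
      have h4 : ‖A k ψ - α k • ψ‖ ≤ ‖A k ψ - z • ψ‖ + ‖α k - z‖ := by
        have : A k ψ - α k • ψ = (A k ψ - z • ψ) - (α k - z) • ψ := by
          rw [sub_smul]
          abel
        rw [this]
        refine (norm_sub_le _ _).trans_eq ?_
        rw [norm_smul, hψ, mul_one]
      have h5 := pow_le_pow_left₀ (norm_nonneg _) h4 2
      nlinarith [sq_nonneg (‖A k ψ - z • ψ‖ - ‖α k - z‖)]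
    have hs : ∑ k, ‖A k ψ - α k • ψ‖ ^ 2 ≤ 6 * g ψ := by
      rw [hg, Finset.mul_sum]
      exact Finset.sum_le_sum fun k _ => hk k
    refine le_trans ?_ hs
    have hnn : 0 ≤ ∑ k, ‖A k ψ - α k • ψ‖ ^ 2 := Finset.sum_nonneg fun k _ => by positivity
    rw [← Real.le_sqrt (norm_nonneg _) hnn, pi_norm_le_iff_of_nonneg (Real.sqrt_nonneg _)]
    intro k
    refine Real.le_sqrt_of_sq_le ?_
    exact Finset.single_le_sum (f := fun k => ‖A k ψ - α k • ψ‖ ^ 2)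
      (fun k _ => by positivity) (Finset.mem_univ k)
  have hS : ‖(LinearMap.pi fun k => B k - (starRingEnd ℂ) (α k) • LinearMap.id :
      E →ₗ[ℂ] κ → E) ψ‖ ^ 2 ≤ C ^ 2 * (6 * g ψ) := by
    refine (pow_le_pow_left₀ (norm_nonneg _) (hle ψ) 2).trans ?_
    rw [mul_pow]
    exact mul_le_mul_of_nonneg_left hT (sq_nonneg C)
  have hk (k : κ) : ‖B k ψ - ⟪ψ, B k ψ⟫ • ψ‖ ^ 2 ≤ C ^ 2 * (6 * g ψ) := by
    refine le_trans (pow_le_pow_left₀ (norm_nonneg _) ?_ 2) hS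
    refine (norm_sub_inner_smul_le hψ _ ((starRingEnd ℂ) (α k))).trans
      (le_trans (le_of_eq ?_) (norm_le_pi_norm _ k))
    rfl
  refine (Finset.sum_le_card_nsmul _ _ _ fun k _ => hk k).trans_eq ?_
  rw [Finset.card_univ, nsmul_eq_mul]
  ring

end

/-- The variance of a matrix in a basis vector is the off-diagonal weight of that column. -/
theorem sum_norm_sq_eq [NeZero n] {U : Matrix (Fin n) (Fin n) ℂ} (hU : Uᴴ * U = 1)
    (W : Matrix (Fin n) (Fin n) ℂ) :
    ‖WithLp.toLp 2 (W *ᵥ (U *ᵥ Pi.single 0 1) -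
      (star (U *ᵥ Pi.single 0 1) ⬝ᵥ W *ᵥ (U *ᵥ Pi.single 0 1)) • (U *ᵥ Pi.single 0 1))‖ ^ 2 =
      ∑ i ∈ Finset.univ.erase 0, ‖(Uᴴ * W * U) i 0‖ ^ 2 := by
  have hU' : U * Uᴴ = 1 := mul_eq_one_comm.1 hU
  rw [← conjTranspose_mul_mul_apply]
  set y := W *ᵥ (U *ᵥ Pi.single 0 1) - (Uᴴ * W * U) 0 0 • (U *ᵥ Pi.single 0 1) with hy
  have hn (z : Fin n → ℂ) : ((‖WithLp.toLp 2 z‖ ^ 2 : ℝ) : ℂ) = star z ⬝ᵥ z := by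
    rw [EuclideanSpace.norm_sq_eq]
    push_cast
    exact Finset.sum_congr rfl fun i _ => (Complex.conj_mul' (z i)).symm
  have h1 : ‖WithLp.toLp 2 y‖ ^ 2 = ‖WithLp.toLp 2 (Uᴴ *ᵥ y)‖ ^ 2 := by
    rw [← Complex.ofReal_inj, hn, hn, Matrix.star_mulVec, ← Matrix.dotProduct_mulVec,
      Matrix.mulVec_mulVec, Matrix.conjTranspose_conjTranspose, hU', Matrix.one_mulVec]
  have h2 : Uᴴ *ᵥ y = (Uᴴ * W * U) *ᵥ Pi.single 0 1 - (Uᴴ * W * U) 0 0 • Pi.single 0 1 := by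
    rw [hy, Matrix.mulVec_sub, Matrix.mulVec_smul, Matrix.mulVec_mulVec, Matrix.mulVec_mulVec,
      Matrix.mulVec_mulVec, hU, Matrix.one_mulVec, Matrix.mul_assoc]
  rw [h1, EuclideanSpace.norm_sq_eq, ← Finset.sum_erase_add _ _ (Finset.mem_univ 0), h2]
  simp only [Matrix.mulVec_single_one, Pi.sub_apply, Pi.smul_apply, Matrix.col_apply,
    Pi.single_eq_same, smul_eq_mul, mul_one, sub_self, norm_zero]
  rw [zero_pow two_ne_zero, add_zero]
  refine Finset.sum_congr rfl fun i hi => ?_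
  rw [Pi.single_eq_of_ne (Finset.ne_of_mem_erase hi), mul_zero, sub_zero]

/-- If every common eigenvector is a common left eigenvector, then the total rate into a basis
vector is controlled by the total rate out of it. -/
theorem exists_rate_bound [NeZero n] {V : Fin r → Matrix (Fin n) (Fin n) ℂ}
    (h : ∀ ψ : Fin n → ℂ, IsCommonEigenvector V ψ → IsCommonLeftEigenvector V ψ) :
    ∃ C : ℝ, 0 ≤ C ∧ ∀ U : Matrix (Fin n) (Fin n) ℂ, Uᴴ * U = 1 →
      ∑ j ∈ Finset.univ.erase 0, jMatrix V U 0 j ≤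
        C * ∑ i ∈ Finset.univ.erase 0, jMatrix V U i 0 := by
  have hin (u v : Fin n → ℂ) : inner ℂ (WithLp.toLp 2 u) (WithLp.toLp 2 v) = star u ⬝ᵥ v := by
    rw [EuclideanSpace.inner_toLp_toLp, dotProduct_comm]
  have hsmul (A : Matrix (Fin n) (Fin n) ℂ) (x : EuclideanSpace ℂ (Fin n)) (α : ℂ) :
      A.toEuclideanLin x = α • x ↔ A *ᵥ x.ofLp = α • x.ofLp :=
    (WithLp.ofLp_injective 2).eq_iff.symm
  obtain ⟨C, hC, hle⟩ := exists_sum_norm_adjoint_sq_le (E := EuclideanSpace ℂ (Fin n))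
    (fun k => (V k).toEuclideanLin) (fun k => (V k)ᴴ.toEuclideanLin)
    (fun k x y => by
      rw [Matrix.toLpLin_apply, Matrix.toLpLin_apply]
      have h1 := hin ((V k)ᴴ *ᵥ x.ofLp) y.ofLp
      have h2 := hin x.ofLp (V k *ᵥ y.ofLp)
      refine h1.trans (Eq.trans ?_ h2.symm)
      rw [Matrix.star_mulVec, Matrix.conjTranspose_conjTranspose, Matrix.dotProduct_mulVec])
    (fun ψ hψ hev k => by
      simp only [hsmul] at hev ⊢
      have h0 : ψ.ofLp ≠ 0 := fun h => hψ (WithLp.ofLp_injective 2 h)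
      exact vecMul_star_eq_smul_iff.1 ((h ψ.ofLp ⟨h0, hev⟩).2 k))
  refine ⟨C, hC, fun U hU => ?_⟩
  have hψ : ‖WithLp.toLp 2 (U *ᵥ Pi.single 0 1)‖ = 1 := by
    have : ‖WithLp.toLp 2 (U *ᵥ Pi.single 0 1)‖ ^ 2 = 1 := by
      have h1 := inner_self_eq_norm_sq_to_K (𝕜 := ℂ) (WithLp.toLp 2 (U *ᵥ Pi.single 0 1))
      rw [hin, Matrix.star_mulVec, ← Matrix.dotProduct_mulVec, Matrix.mulVec_mulVec, hU,
        Matrix.one_mulVec] at h1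
      have h2 : star (Pi.single 0 1 : Fin n → ℂ) ⬝ᵥ Pi.single 0 1 = 1 := by simp
      rw [h2] at h1
      refine Complex.ofReal_injective ?_
      push_cast
      exact h1.symm
    nlinarith [norm_nonneg (WithLp.toLp 2 (U *ᵥ Pi.single 0 1))]
  have key (W : Matrix (Fin n) (Fin n) ℂ) :
      ‖W.toEuclideanLin (WithLp.toLp 2 (U *ᵥ Pi.single 0 1)) -
        inner ℂ (WithLp.toLp 2 (U *ᵥ Pi.single 0 1))
          (W.toEuclideanLin (WithLp.toLp 2 (U *ᵥ Pi.single 0 1))) •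
          WithLp.toLp 2 (U *ᵥ Pi.single 0 1)‖ ^ 2 =
      ∑ i ∈ Finset.univ.erase 0, ‖(Uᴴ * W * U) i 0‖ ^ 2 := by
    rw [← sum_norm_sq_eq hU, Matrix.toLpLin_apply, hin]
    rfl
  have := hle _ hψ
  simp only [key] at this
  simp only [jMatrix_apply]
  rw [Finset.sum_comm, Finset.sum_comm (s := Finset.univ.erase 0) (t := Finset.univ)]
  refine le_trans (Finset.sum_le_sum fun k _ => Finset.sum_le_sum fun i _ => le_of_eq ?_) this
  rw [← norm_star, ← Matrix.conjTranspose_apply, Matrix.conjTranspose_mul,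
    Matrix.conjTranspose_mul, Matrix.conjTranspose_conjTranspose, Matrix.mul_assoc]

/-! ### The barrier for the first coordinate -/

/-- After the last time at which `f ≤ m`, the derivative is nonpositive almost everywhere, and
absolute continuity allows integrating it. -/
theorem le_of_ae_deriv_nonpos {f : ℝ → ℝ} {T m : ℝ} (hT : 0 ≤ T)
    (hf : AbsolutelyContinuousOnInterval f 0 T) (h0 : f 0 ≤ m)
    (hd : ∀ᵐ t, t ∈ Icc 0 T → m < f t → deriv f t ≤ 0) : f T ≤ m := by
  by_contra! hlt
  have hcont : ContinuousOn f (Icc 0 T) := by simpa [uIcc_of_le hT] using hf.continuousOn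
  have hK : IsCompact (Icc 0 T ∩ f ⁻¹' Iic m) :=
    isCompact_Icc.of_isClosed_subset (hcont.preimage_isClosed_of_isClosed isClosed_Icc isClosed_Iic)
      inter_subset_left
  obtain ⟨s, ⟨hs, hsm⟩, hmax⟩ :=
    hK.exists_isMaxOn ⟨0, ⟨le_rfl, hT⟩, h0⟩ continuous_id.continuousOn
  have hgt (t : ℝ) (ht : t ∈ Ioc s T) : m < f t := by
    by_contra! hle
    exact absurd (hmax (show t ∈ Icc 0 T ∩ f ⁻¹' Iic m from ⟨⟨hs.1.trans ht.1.le, ht.2⟩, hle⟩))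
      (not_le.2 ht.1)
  have hint := (hf.mono (c := s) (d := T) (by
    rw [uIcc_of_le hs.2, uIcc_of_le hT]
    exact Icc_subset_Icc_left hs.1)).integral_deriv_eq_sub
  rw [intervalIntegral.integral_of_le hs.2] at hint
  have := setIntegral_nonpos_ae (μ := volume) (measurableSet_Ioc (a := s) (b := T))
    (hd.mono fun t ht hts => ht ⟨hs.1.trans hts.1.le, hts.2⟩ (hgt t hts))
  have hsm : f s ≤ m := hsm
  linarith

theorem absolutelyContinuousOnInterval_apply {l : ℝ → Fin n → ℝ} {a b : ℝ}
    (h : AbsolutelyContinuousOnInterval l a b) (i : Fin n) :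
    AbsolutelyContinuousOnInterval (fun t => l t i) a b := by
  rw [absolutelyContinuousOnInterval_iff] at h ⊢
  intro ε hε
  obtain ⟨δ, hδ, hE⟩ := h ε hε
  refine ⟨δ, hδ, fun E hE₁ hE₂ => (Finset.sum_le_sum fun k _ => ?_).trans_lt (hE E hE₁ hE₂)⟩
  exact dist_le_pi_dist _ _ i

theorem exists_reach_apply_zero_le [NeZero n] {V : Fin r → Matrix (Fin n) (Fin n) ℂ}
    (h : ∀ ψ : Fin n → ℂ, IsCommonEigenvector V ψ → IsCommonLeftEigenvector V ψ) :
    ∃ b : ℝ, b < 1 ∧ ∀ l₀, ∀ x ∈ reach V l₀, x 0 ≤ max (l₀ 0) b := by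
  obtain ⟨C, hC, hrate⟩ := exists_rate_bound h
  -- With outflow rate `s`, the derivative of the first coordinate `x` is at most `s (C (1 - x) -
  -- x)`, which is nonpositive once `x ≥ C / (C + 1)`.
  refine ⟨C / (C + 1), by rw [div_lt_one (by positivity)]; linarith, fun l₀ x hx => ?_⟩
  simp only [reach, mem_iUnion] at hx
  obtain ⟨T, hT, l, ⟨hmem, hac, U, -, hU⟩, rfl, rfl⟩ := hx
  have hT : 0 ≤ T := hT
  refine le_of_ae_deriv_nonpos hT
    (absolutelyContinuousOnInterval_apply (hac T hT subset_rfl) 0) (le_max_left _ _) ?_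
  rw [ae_restrict_iff' measurableSet_Icc] at hU
  filter_upwards [hU] with t ht htI hlt
  rw [(hasDerivAt_pi.1 (ht htI) 0).deriv]
  set W : Matrix (Fin n) (Fin n) ℂ := (U t).1
  have hW : Wᴴ * W = 1 :=
    Matrix.mem_unitaryGroup_iff'.1 (Matrix.mem_specialUnitaryGroup_iff.1 (U t).2).1
  have hl := hmem t htI
  have hsum : ∑ j ∈ Finset.univ.erase 0, l t j = 1 - l t 0 := by
    rw [eq_sub_iff_add_eq, Finset.sum_erase_add _ _ (Finset.mem_univ _), hl.2]
  have hlow := (le_max_right _ _).trans hlt.le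
  rw [div_le_iff₀ (by positivity)] at hlow
  set s := ∑ i ∈ Finset.univ.erase 0, jMatrix V W i 0 with hs
  have hs0 : 0 ≤ s := Finset.sum_nonneg fun i _ => jMatrix_nonneg V W i 0
  have hin : ∑ j ∈ Finset.univ.erase 0, inducedField V W 0 j * l t j ≤ C * s * (1 - l t 0) := by
    have h1 : 0 ≤ 1 - l t 0 := by
      rw [← hsum]
      exact Finset.sum_nonneg fun j _ => hl.1 j
    refine le_trans ?_ (mul_le_mul_of_nonneg_right (hrate W hW) h1)
    rw [Finset.sum_mul]
    refine Finset.sum_le_sum fun j hj => ?_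
    rw [inducedField_apply_of_ne V W (Finset.ne_of_mem_erase hj).symm]
    refine mul_le_mul_of_nonneg_left ?_ (jMatrix_nonneg V W 0 j)
    rw [← hsum]
    exact Finset.single_le_sum (fun j _ => hl.1 j) hj
  have h00 : inducedField V W 0 0 = -s := by
    rw [inducedField_apply_self, ← Finset.sum_erase_add _ _ (Finset.mem_univ 0)]
    ring
  rw [Matrix.mulVec, dotProduct, ← Finset.sum_erase_add _ _ (Finset.mem_univ 0), h00]
  nlinarith

theorem exists_eigenvector_of_mem_closure_reach [NeZero n]
    {V : Fin r → Matrix (Fin n) (Fin n) ℂ} {l₀ : Fin n → ℝ} (hl₀ : l₀ ∈ stdSimplex ℝ (Fin n))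
    (hne : l₀ ≠ Pi.single 0 1) (h : Pi.single 0 1 ∈ closure (reach V l₀)) :
    ∃ ψ : Fin n → ℂ, IsCommonEigenvector V ψ ∧ ¬ IsCommonLeftEigenvector V ψ := by
  by_contra! hall
  obtain ⟨b, hb, hle⟩ := exists_reach_apply_zero_le hall
  have hlt : l₀ 0 < 1 := by
    have hsum := hl₀.2
    rw [← Finset.sum_erase_add _ _ (Finset.mem_univ 0)] at hsum
    have hnn : 0 ≤ ∑ j ∈ Finset.univ.erase 0, l₀ j := Finset.sum_nonneg fun j _ => hl₀.1 j
    refine lt_of_le_of_ne (by linarith) fun h1 => hne (funext fun j => ?_)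
    rw [h1, add_eq_right, Finset.sum_eq_zero_iff_of_nonneg fun j _ => hl₀.1 j] at hsum
    rcases eq_or_ne j 0 with rfl | hj
    · rw [h1, Pi.single_eq_same]
    · rw [Pi.single_eq_of_ne hj, hsum j (Finset.mem_erase.2 ⟨hj, Finset.mem_univ j⟩)]
  have hcl : closure (reach V l₀) ⊆ {x | x 0 ≤ max (l₀ 0) b} :=
    closure_minimal (hle l₀) (isClosed_le (continuous_apply 0) continuous_const)
  have := hcl h
  rw [mem_ofPred_eq, Pi.single_eq_same] at this
  exact absurd this (not_le.2 (max_lt hlt hb))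

theorem exists_mem_closure_reach [NeZero n] (hn : 2 ≤ n) {V : Fin r → Matrix (Fin n) (Fin n) ℂ}
    (h : ∀ l₀ ∈ stdSimplex ℝ (Fin n), ∃ l : ℝ → Fin n → ℝ,
      IsReducedSolution V (Ici 0) l ∧ l 0 = l₀ ∧ Tendsto l atTop (𝓝 (Pi.single 0 1))) :
    ∃ l₀ ∈ stdSimplex ℝ (Fin n) \ {Pi.single 0 1}, Pi.single 0 1 ∈ closure (reach V l₀) := by
  -- The second vertex, available since `n ≥ 2`, serves as the starting point.
  have hmem := single_mem_stdSimplex ℝ (⟨1, hn⟩ : Fin n)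
  obtain ⟨l, ⟨h₁, h₂, U, h₃, h₄⟩, h0, hlim⟩ := h _ hmem
  refine ⟨_, ⟨hmem, fun heq => ?_⟩, mem_closure_of_tendsto hlim
    ((eventually_ge_atTop 0).mono fun T hT => mem_biUnion (x := T) hT
      ⟨l, ⟨?_, ?_, U, h₃, ?_⟩, h0, rfl⟩)⟩
  · have := congrFun (mem_singleton_iff.1 heq) 0
    rw [Pi.single_eq_same, Pi.single_eq_of_ne (by simp [Fin.ext_iff])] at this
    exact zero_ne_one this
  · exact fun t ht => h₁ t ht.1
  · exact fun S hS _ => h₂ S hS Icc_subset_Ici_self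
  · exact ae_restrict_of_ae_restrict_of_subset Icc_subset_Ici_self h₄

end MarkovCooling

theorem mainTheorem1 (n : ℕ) (hn : 2 ≤ n)
    (L : Matrix (Fin n) (Fin n) ℂ →ₗ[ℂ] Matrix (Fin n) (Fin n) ℂ)
    (r : ℕ) (H₀ : Matrix (Fin n) (Fin n) ℂ) (V : Fin r → Matrix (Fin n) (Fin n) ℂ)
    (hL : MarkovCooling.HasLindbladForm L H₀ V)
    (e₁ : Fin n → ℝ) (he₁ : e₁ = Pi.single ⟨0, by omega⟩ 1) :
    List.TFAE [
      -- every choice of Lindblad terms has a common eigenvector that is not a common left one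
      ∀ (r' : ℕ) (H' : Matrix (Fin n) (Fin n) ℂ) (V' : Fin r' → Matrix (Fin n) (Fin n) ℂ),
        MarkovCooling.HasLindbladForm L H' V' →
          ∃ ψ : Fin n → ℂ, MarkovCooling.IsCommonEigenvector V' ψ ∧
            ¬ MarkovCooling.IsCommonLeftEigenvector V' ψ,
      -- some Hamiltonian produces a (unique) attractive fixed point, which is pure
      ∃ H : Matrix (Fin n) (Fin n) ℂ, H.IsHermitian ∧
        ∃ ρ : Matrix (Fin n) (Fin n) ℂ,
          MarkovCooling.IsAttractiveFixedPoint (-(Complex.I • MarkovCooling.ad H + L)) ρ ∧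
          (∀ σ : Matrix (Fin n) (Fin n) ℂ,
            MarkovCooling.IsAttractiveFixedPoint (-(Complex.I • MarkovCooling.ad H + L)) σ →
              σ = ρ) ∧
          MarkovCooling.IsPure ρ,
      -- from every initial state some solution converges to the first vertex
      ∀ l₀ ∈ stdSimplex ℝ (Fin n), ∃ l : ℝ → Fin n → ℝ,
        MarkovCooling.IsReducedSolution V (Set.Ici 0) l ∧ l 0 = l₀ ∧
          Filter.Tendsto l Filter.atTop (nhds e₁),
      -- the first vertex is in the closure of the reachable set of some other point
      ∃ l₀ ∈ stdSimplex ℝ (Fin n) \ {e₁}, e₁ ∈ closure (MarkovCooling.reach V l₀)] := by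
  have : NeZero n := ⟨by omega⟩
  replace he₁ : e₁ = Pi.single 0 1 := he₁
  subst he₁
  tfae_have 1 → 2 := fun h => by
    obtain ⟨H, hH, ψ, hψ, hfix⟩ := hL.exists_isAttractiveFixedPoint hn (h r H₀ V hL)
    refine ⟨H, hH, _, hfix, fun σ hσ => ?_, ψ, hψ, rfl⟩
    -- The constant curve at the fixed point is itself a solution, so it must converge to any other
    -- attractive fixed point.
    refine tendsto_nhds_unique (hσ.2.2 (fun _ => Matrix.vecMulVec ψ (star ψ))
      ⟨fun _ _ => hfix.1, fun t _ i j => ?_⟩) tendsto_const_nhds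
    rw [hfix.2.1]
    exact hasDerivWithinAt_const t _ _
  tfae_have 2 → 1 := by
    rintro ⟨H, hH, _, hfix, -, ψ, hψ, rfl⟩ r' H' V' hL'
    have hform := hL'.add_ad hH
    exact ⟨ψ, hform.isCommonEigenvector_of_apply_eq_zero hψ hfix.2.1,
      hform.not_isCommonLeftEigenvector hn hψ hfix⟩
  tfae_have 1 → 3 := fun h l₀ hl₀ =>
    MarkovCooling.exists_isReducedSolution_tendsto hn (h r H₀ V hL) hl₀
  tfae_have 3 → 4 := MarkovCooling.exists_mem_closure_reach hn
  tfae_have 4 → 1 := by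
    rintro ⟨l₀, hl₀, hcl⟩ r' H' V' hL'
    exact hL.exists_eigenvector_congr hL' (MarkovCooling.exists_eigenvector_of_mem_closure_reach
      hl₀.1 hl₀.2 hcl)
  tfae_finish
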